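/- Let $L$ be a nontrivial finite group and let $G=(\mathbb Z\times\mathbb Z_2)\wr L$ be the lamplighter group (restricted wreath product): its elements are pairs $(\gamma,f)$ with $\gamma\in\Gamma=\mathbb Z\times\mathbb Z_2$ and $f:\Gamma\to L$ of finite support, with $(\gamma,f)(\gamma',f')=(\gamma+\gamma',\,x\mapsto f(x)f'(x-\gamma))$. Regard $\gamma\in\Gamma$ as the element $(\gamma,1)$ of $G$, and for $x\in\Gamma$, $l\in L$ let $l\,\delta_x\in G$ be the element with trivial position whose lamp at $x$ is $l$ and whose other lamps are trivial; regard $l\in L$ as $l\,\delta_{(0,0)}$. For a finite generating set $S$ of a group $G$, write $|g|$ for the distance from the identity to $g$ in the Cayley graph of $(G,S)$, $B(n)=\{g:|g|\le n\}$ ($=\emptyset$ for $n<0$), and let $S(n,r)^\infty$ be the set of $g\in B(n+r)$ lying in an infinite connected component of the complement of $B(n-1)$. The connection thickness $\mathrm{th}_{G,S}(n)\in\mathbb Z_{\ge0}\cup\{\infty\}$ is the least $r\ge 0$ such that the subgraph of the Cayley graph induced on $S(n,r)^\infty$ is connected. The retreat depth of $g\in G$ is the least $d\ge0$ such that $g$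 lies in an infinite connected component of the complement of $B(|g|-d-1)$. A dead-end is an element $g$ none of whose neighbours $h$ satisfies $|h|>|g|$. 1. The set $S=L\{(\pm1,0),(0,1)\}L$ is a finite generating set of $G$; for it, $\mathrm{th}_{G,S}(n)\le 24$ for all $n\ge0$, and every element of $G$ (in particular every dead-end) has retreat depth at most $5$. 2. The set $$S_1=\{\,l\delta_{(0,0)}\,l'\delta_{(0,1)}\cdot(\pm1,\varepsilon)\cdot m\delta_{(0,0)}\,m'\delta_{(0,1)} \;:\; l,l',m,m'\in L,\ \varepsilon\in\mathbb Z_2\,\}$$ ("switch the two lamps at the current $\mathbb Z$-coordinate, walk, switch the two lamps at the new $\mathbb Z$-coordinate") is a finite generating set of $G$; for it, $\mathrm{th}_{G,S_1}(n)=n+2$ for all $n\ge2$, and for every $d$ there is a dead-end of retreat depth at least $d$. -/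

import Mathlib

/-! ### Cayley graphs: word length, annuli, connection thickness, retreat depth -/

section CayleyGeometry

variable {G : Type*} [Group G]

/-- The word length `|g| = d(e, g)`: distance from the identity in the Cayley graph of `(G, S)`. -/
noncomputable def wordLength (S : Set G) (g : G) : ℕ :=
  (SimpleGraph.mulCayley S).dist 1 g

/-- The complement of the ball `B(n - 1)`, i.e. the set of elements of length at least `n`. -/
def outerSet (S : Set G) (n : ℕ) : Set G :=
  {g | n ≤ wordLength S g}

/-- The connected component of `g` in the subgraph of the Cayley graph spanned by the complement
of `B(n - 1)` (empty when `g` lies in `B(n - 1)`). -/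
def outerComponent (S : Set G) (n : ℕ) (g : G) : Set G :=
  {h | ∃ (hg : g ∈ outerSet S n) (hh : h ∈ outerSet S n),
    ((SimpleGraph.mulCayley S).induce (outerSet S n)).Reachable ⟨g, hg⟩ ⟨h, hh⟩}

/-- The elements lying in an infinite component of the complement of `B(n - 1)`.
In a one-ended group this is the unique infinite component. -/
def infinitePart (S : Set G) (n : ℕ) : Set G :=
  {g | (outerComponent S n g).Infinite}

/-- `S(n, r)^∞`: the elements of the annulus of radius `n` and thickness `r` which lie in an
infinite component of the complement of `B(n - 1)`. -/
def annulusInf (S : Set G) (n r : ℕ) : Set G :=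
  {g | wordLength S g ≤ n + r ∧ g ∈ infinitePart S n}

/-- The connection thickness: the least `r` such that the subgraph of the Cayley graph spanned by
`S(n, r)^∞` is connected, and `⊤` if there is none. -/
noncomputable def connectionThickness (S : Set G) (n : ℕ) : ℕ∞ :=
  sInf ((fun r : ℕ => (r : ℕ∞)) ''
    {r : ℕ | ((SimpleGraph.mulCayley S).induce (annulusInf S n r)).Connected})

/-- The retreat depth of `g`: the least `d` such that `g` belongs to an infinite component of the
complement of `B(|g| - d - 1)`, and `⊤` if there is none. For `d ≥ |g|` the ball is empty, in
agreement with the truncated subtraction. -/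
noncomputable def retreatDepth (S : Set G) (g : G) : ℕ∞ :=
  sInf ((fun d : ℕ => (d : ℕ∞)) '' {d : ℕ | g ∈ infinitePart S (wordLength S g - d)})

/-- A dead-end: a vertex not adjacent to any vertex further away from the identity. -/
def IsDeadEnd (S : Set G) (g : G) : Prop :=
  ∀ h : G, (SimpleGraph.mulCayley S).Adj g h → wordLength S h ≤ wordLength S g

end CayleyGeometry

/-! ### Lamplighter groups -/

/-- The lamplighter group `Γ ≀ L` (restricted wreath product) over an additively written base
group `Γ`: a position in `Γ` and a finitely supported lamp configuration `Γ → L`. -/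
@[ext]
structure Lamplighter (Γ L : Type*) [Group L] where
  /-- the position of the lamplighter -/
  pos : Γ
  /-- the lamp configuration -/
  lamp : Γ → L
  /-- only finitely many lamps are on -/
  finite_mulSupport : (Function.mulSupport lamp).Finite

namespace Lamplighter

section Group

variable {Γ L : Type*} [AddGroup Γ] [Group L]

/-- `(γ, f) (γ', f') = (γ γ', x ↦ f x * f' (γ⁻¹ x))`, with `Γ` written additively. -/
instance : Mul (Lamplighter Γ L) where
  mul g h :=
    { pos := g.pos + h.pos
      lamp := fun x => g.lamp x * h.lamp (-g.pos + x)
      finite_mulSupport := by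
        refine (g.finite_mulSupport.union
          (h.finite_mulSupport.preimage (f := fun x => -g.pos + x) ?_)).subset ?_
        · exact (add_right_injective (-g.pos)).injOn
        · intro x hx
          by_contra hne
          simp only [Set.mem_union, Set.mem_preimage, Function.mem_mulSupport, not_or,
            not_not] at hne
          exact hx (by simp [hne.1, hne.2]) }

instance : One (Lamplighter Γ L) where
  one := { pos := 0, lamp := fun _ => 1, finite_mulSupport := by simp }

instance : Inv (Lamplighter Γ L) where
  inv g :=
    { pos := -g.pos
      lamp := fun x => (g.lamp (g.pos + x))⁻¹
      finite_mulSupport := by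
        refine (g.finite_mulSupport.preimage (f := fun x => g.pos + x) ?_).subset ?_
        · exact (add_right_injective g.pos).injOn
        · intro x hx
          simpa using hx }

@[simp] theorem mul_pos' (g h : Lamplighter Γ L) : (g * h).pos = g.pos + h.pos := rfl

@[simp] theorem mul_lamp (g h : Lamplighter Γ L) (x : Γ) :
    (g * h).lamp x = g.lamp x * h.lamp (-g.pos + x) := rfl

@[simp] theorem one_pos' : (1 : Lamplighter Γ L).pos = 0 := rfl

@[simp] theorem one_lamp (x : Γ) : (1 : Lamplighter Γ L).lamp x = 1 := rfl

@[simp] theorem inv_pos' (g : Lamplighter Γ L) : g⁻¹.pos = -g.pos := rfl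

@[simp] theorem inv_lamp (g : Lamplighter Γ L) (x : Γ) :
    g⁻¹.lamp x = (g.lamp (g.pos + x))⁻¹ := rfl

instance : Group (Lamplighter Γ L) :=
  Group.ofLeftAxioms
    (fun a b c => by
      ext x
      · simp [add_assoc]
      · simp [mul_assoc, add_assoc])
    (fun a => by
      ext x
      · simp
      · simp)
    (fun a => by
      ext x
      · simp
      · simp)

/-- The element `(γ, Id)`: the lamplighter walks by `γ`. -/
def walk (γ : Γ) : Lamplighter Γ L where
  pos := γ
  lamp := fun _ => 1
  finite_mulSupport := by simp

/-- The element whose position is trivial and whose only possibly lit lamp is the one at `x`,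
in state `l`. For `x = 0` this switches the lamp at the current position. -/
def switchAt [DecidableEq Γ] (x : Γ) (l : L) : Lamplighter Γ L where
  pos := 0
  lamp := Pi.mulSingle x l
  finite_mulSupport := (Set.finite_singleton x).subset Pi.mulSupport_mulSingle_subset

/-- The switch-walk-switch set `L W L` associated with a set `W` of moves in the base group. -/
def switchWalkSwitch [DecidableEq Γ] (W : Set Γ) : Set (Lamplighter Γ L) :=
  {g | ∃ l m : L, ∃ w ∈ W, g = switchAt 0 l * walk w * switchAt 0 m}

end Group

/-! ### The ladder `ℤ × ℤ₂` -/

variable (L : Type*) [Group L]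

/-- The switch-walk-switch set `L {(±1, 0), (0, 1)} L` of the lamplighter group on the ladder. -/
def ladderGenerators : Set (Lamplighter (ℤ × ZMod 2) L) :=
  switchWalkSwitch {(1, 0), (-1, 0), (0, 1)}

variable {L} in
/-- Switch both lamps that have the current `ℤ`-coordinate: the one at the current position by `l`,
the other one by `l'`. -/
def switchBoth (l l' : L) : Lamplighter (ℤ × ZMod 2) L :=
  switchAt (0, 0) l * switchAt (0, 1) l'

/-- The set of elements "switch both lamps with the current `ℤ`-coordinate, walk by `(±1, ε)`,
switch both lamps with the new `ℤ`-coordinate". -/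
def doubleSwitchGenerators : Set (Lamplighter (ℤ × ZMod 2) L) :=
  {g | ∃ l l' m m' : L, ∃ w : ℤ × ZMod 2, (w.1 = 1 ∨ w.1 = -1) ∧
    g = switchBoth l l' * walk w * switchBoth m m'}

end Lamplighter

/-!
Write `|g|` for the word length, `x` for the column (the `ℤ`-coordinate) of the position of `g`, and
`[-a, b]` for the hull of `0`, `x` and the columns of the lit lamps of `g`; in the code `b` is
`reach g` and `a` is `reach (mirror g)`, where `mirror` reverses the ladder.

**Switch-walk-switch generators.** Here `|g|` is the least length of a tour of the ladder from the
origin to the position of `g` which covers the lit lamps (`ladder_metric`). The point is that a walk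
along the ladder can be made *neutral*. Suppose `0 ≤ x` and move right from `x` to `c`, lighting
both lamps of each column (`fill`). To cover these columns, a tour of `g` goes along one row and
comes back along the other, which costs `2 (c - x)` up to a constant; covering both rows of the
columns from `x` to `c` in a single pass costs the same. Cutting a tour at a column (`Tour.trunc`)
and extending it again (`Tour.loop`, `Tour.zigzag`) turns this into the inequalities
`|g| ≤ |fill g c| + 3` and, for `c ≤ b`, `|fill g c| ≤ |g| + 4`.

The first inequality shows that one can walk to infinity from any element while losing at most `4`,
whence the bound on the retreat depth. For the thickness, attach to each element `g` with
`|g| ≤ n + 4` its extensions (`Extends`): one more lamp is lit, on the right if `0 ≤ x` and on the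
left if `x ≤ 0`, so far away that the length becomes about `n + 8` or `n + 4` respectively. Neutral
walks allow to move the far lamp by one column at constant cost, so that the extensions of adjacent
elements are linked in the annulus, and so are the left and the right extensions of an element with
`x = 0`, for which the far lamps are moved in turn. Following a geodesic to the identity, the
extensions of all elements are linked together. It remains that an element of length `n + 4` is
linked to its extensions, and that any element of the annulus is linked to one of length `n + 4`.

**Double-switch generators.** The two lamps of a column are switched together, so that walking is as
in `ℤ` and `|g| = 2 (a + b) - |x|`, up to an exception for `a = b = 0` (`tripLength`). With `x = 0`
and `a = b = m` the element is a dead-end of length `4 m`; moving to an end of the hull without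
changing the latter makes the length drop to `3 m`, so the retreat depth is at least `m`. In an
annulus between `n` and `2 n + 1`, an element with `a = 0` and `n ≤ b` always keeps `n ≤ b` and
cannot move beyond the column `-1` (`not_linked_walk`). With the upper bound `2 n + 2`, hulls of
width `n + 1` can be crossed from one end to the other, and be moved to the right by one column at
each round trip, until `a = 0` (`linked_farLamp_of_width`).
-/

/-! ### Paths, components and word length in Cayley graphs -/

namespace Cayley

open SimpleGraph

variable {G : Type*} [Group G] {S : Set G}

/-- `g` and `h` are linked in `A` when some path of the Cayley graph joins them inside `A`
(the trivial path at `g = h` being allowed even if `g ∉ A`). -/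
def Linked (S A : Set G) : G → G → Prop :=
  Relation.ReflTransGen fun g h => (mulCayley S).Adj g h ∧ g ∈ A ∧ h ∈ A

namespace Linked

variable {A B : Set G} {g h k : G}

theorem refl (g : G) : Linked S A g g := Relation.ReflTransGen.refl

theorem trans (h₁ : Linked S A g h) (h₂ : Linked S A h k) : Linked S A g k :=
  Relation.ReflTransGen.trans h₁ h₂

theorem symm (h₁ : Linked S A g h) : Linked S A h g := by
  induction h₁ with
  | refl => exact refl g
  | tail _ hbc ih => exact (Relation.ReflTransGen.single ⟨hbc.1.symm, hbc.2.2, hbc.2.1⟩).trans ih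

theorem of_adj (hadj : (mulCayley S).Adj g h) (hg : g ∈ A) (hh : h ∈ A) : Linked S A g h :=
  Relation.ReflTransGen.single ⟨hadj, hg, hh⟩

theorem mono (hAB : A ⊆ B) (h₁ : Linked S A g h) : Linked S B g h :=
  h₁.lift id fun _ _ hab => ⟨hab.1, hAB hab.2.1, hAB hab.2.2⟩

theorem mem (h₁ : Linked S A g h) (hg : g ∈ A) : h ∈ A := by
  induction h₁ with
  | refl => exact hg
  | tail _ hbc _ => exact hbc.2.2

/-- A property inherited along the edges inside `A` is inherited along paths inside `A`. -/
theorem invariant {P : G → Prop}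
    (hP : ∀ a b, (mulCayley S).Adj a b → a ∈ A → b ∈ A → P a → P b)
    (h₁ : Linked S A g h) (hg : P g) : P h := by
  induction h₁ with
  | refl => exact hg
  | tail _ hbc ih => exact hP _ _ hbc.1 hbc.2.1 hbc.2.2 ih

theorem reachable (h₁ : Linked S A g h) (hg : g ∈ A) (hh : h ∈ A) :
    ((mulCayley S).induce A).Reachable ⟨g, hg⟩ ⟨h, hh⟩ := by
  induction h₁ with
  | refl => exact Reachable.refl _
  | @tail b c _ hbc ih =>
    exact (ih hbc.2.1).trans (Adj.reachable (G := (mulCayley S).induce A) (by simpa using hbc.1))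

/-- Maps respecting adjacency carry links to links. -/
theorem map {φ : G → G} (hφ : ∀ a b, (mulCayley S).Adj a b → (mulCayley S).Adj (φ a) (φ b))
    (hA : ∀ a ∈ A, φ a ∈ B) (h₁ : Linked S A g h) : Linked S B (φ g) (φ h) := by
  induction h₁ with
  | refl => exact refl _
  | tail _ hbc ih => exact ih.trans (of_adj (hφ _ _ hbc.1) (hA _ hbc.2.1) (hA _ hbc.2.2))

end Linked

theorem linked_of_reachable {A : Set G} {g h : A} (H : ((mulCayley S).induce A).Reachable g h) :
    Linked S A g h := by
  obtain ⟨w⟩ := H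
  induction w with
  | nil => exact Linked.refl _
  | @cons a b c hab _ ih =>
    exact (Linked.of_adj (by simpa using hab) a.2 b.2).trans ih

theorem mem_outerComponent_iff {n : ℕ} {g h : G} :
    h ∈ outerComponent S n g ↔ g ∈ outerSet S n ∧ Linked S (outerSet S n) g h := by
  constructor
  · rintro ⟨hg, hh, H⟩
    exact ⟨hg, linked_of_reachable H⟩
  · rintro ⟨hg, H⟩
    exact ⟨hg, H.mem hg, H.reachable hg (H.mem hg)⟩

theorem infinitePart_subset_outerSet (n : ℕ) : infinitePart S n ⊆ outerSet S n := by
  intro g hg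
  obtain ⟨h, hh⟩ := Set.Infinite.nonempty hg
  exact (mem_outerComponent_iff.1 hh).1

theorem infinitePart_of_linked {n : ℕ} {g h : G} (hg : g ∈ infinitePart S n)
    (H : Linked S (outerSet S n) g h) : h ∈ infinitePart S n := by
  refine Set.Infinite.mono ?_ hg
  intro k hk
  have hg' := infinitePart_subset_outerSet n hg
  exact mem_outerComponent_iff.2 ⟨H.mem hg', H.symm.trans (mem_outerComponent_iff.1 hk).2⟩

theorem infinitePart_anti {m n : ℕ} (h : m ≤ n) : infinitePart S n ⊆ infinitePart S m := by
  intro g hg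
  refine Set.Infinite.mono ?_ hg
  intro k hk
  have hsub : outerSet S n ⊆ outerSet S m := fun _ hx => h.trans hx
  rw [mem_outerComponent_iff] at hk ⊢
  exact ⟨hsub hk.1, hk.2.mono hsub⟩

/-- The annulus of the elements whose length lies between `lo` and `hi`. -/
def annulus (S : Set G) (lo hi : ℕ) : Set G :=
  {g | lo ≤ wordLength S g ∧ wordLength S g ≤ hi}

theorem annulusInf_subset (n r : ℕ) : annulusInf S n r ⊆ annulus S n (n + r) :=
  fun _ hg => ⟨infinitePart_subset_outerSet n hg.2, hg.1⟩

/-- The annulus `S(n, r)^∞` is connected as soon as one of its elements is linked, inside the whole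
annulus, to all the others: paths which start in an infinite component never leave it. -/
theorem annulusInf_connected {n r : ℕ} {z : G} (hz : z ∈ annulusInf S n r)
    (H : ∀ g ∈ annulusInf S n r, Linked S (annulus S n (n + r)) g z) :
    ((mulCayley S).induce (annulusInf S n r)).Connected := by
  have key : ∀ g ∈ annulusInf S n r, ∀ h, Linked S (annulus S n (n + r)) g h →
      Linked S (annulusInf S n r) g h ∧ h ∈ annulusInf S n r := by
    intro g hg h hgh
    induction hgh with
    | refl => exact ⟨Linked.refl _, hg⟩
    | @tail b c _ hbc ih =>
      have hc : c ∈ annulusInf S n r :=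
        ⟨hbc.2.2.2, infinitePart_of_linked ih.2.2
          (Linked.of_adj hbc.1 hbc.2.1.1 hbc.2.2.1)⟩
      exact ⟨ih.1.trans (Linked.of_adj hbc.1 ih.2 hc), hc⟩
  have : Nonempty (annulusInf S n r) := ⟨⟨z, hz⟩⟩
  refine Connected.mk ?_
  intro g h
  have h₁ := (key g g.2 z (H g g.2)).1
  have h₂ := (key h h.2 z (H h h.2)).1
  exact (h₁.trans h₂.symm).reachable g.2 h.2

theorem linked_of_annulusInf_connected {n r : ℕ}
    (H : ((mulCayley S).induce (annulusInf S n r)).Connected) {g h : G}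
    (hg : g ∈ annulusInf S n r) (hh : h ∈ annulusInf S n r) :
    Linked S (annulus S n (n + r)) g h :=
  (linked_of_reachable (H.preconnected ⟨g, hg⟩ ⟨h, hh⟩)).mono (annulusInf_subset n r)

theorem connectionThickness_le {n r : ℕ}
    (H : ((mulCayley S).induce (annulusInf S n r)).Connected) : connectionThickness S n ≤ r :=
  sInf_le ⟨r, H, rfl⟩

theorem retreatDepth_le {g : G} {d : ℕ} (H : g ∈ infinitePart S (wordLength S g - d)) :
    retreatDepth S g ≤ d :=
  sInf_le ⟨d, H, rfl⟩

@[simp] theorem wordLength_one : wordLength S (1 : G) = 0 := by simp [wordLength]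

theorem wordLength_le_succ (hS : (mulCayley S).Connected) {g h : G}
    (hgh : (mulCayley S).Adj g h) : wordLength S h ≤ wordLength S g + 1 := by
  have := hS.dist_triangle (u := 1) (v := g) (w := h)
  rwa [dist_eq_one_iff_adj.2 hgh] at this

theorem eq_one_of_wordLength_eq_zero (hS : (mulCayley S).Connected) {g : G}
    (hg : wordLength S g = 0) : g = 1 :=
  (hS.dist_eq_zero_iff.1 hg).symm

theorem exists_adj_wordLength (hS : (mulCayley S).Connected) {g : G} {k : ℕ}
    (hg : wordLength S g = k + 1) : ∃ h, (mulCayley S).Adj g h ∧ wordLength S h = k := by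
  obtain ⟨w, hw⟩ := hS.exists_walk_length_eq_dist g 1
  have hlen : w.length = k + 1 := by rw [hw, dist_comm]; exact hg
  cases w with
  | nil => simp at hlen
  | @cons _ b _ hab p =>
    refine ⟨b, hab, ?_⟩
    have h₁ : wordLength S b ≤ k := by
      rw [wordLength, dist_comm]
      have := dist_le p
      simp only [Walk.length_cons] at hlen
      omega
    have h₂ := wordLength_le_succ hS hab.symm
    omega

theorem finite_ball (hS : (mulCayley S).Connected) (hfin : S.Finite) (k : ℕ) :
    {g : G | wordLength S g ≤ k}.Finite := by
  induction k with
  | zero =>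
    refine (Set.finite_singleton (1 : G)).subset fun g hg => ?_
    exact eq_one_of_wordLength_eq_zero hS (Nat.le_zero.1 hg)
  | succ k ih =>
    refine (ih.union (ih.mul (hfin.union hfin.inv))).subset fun g hg => ?_
    rcases Nat.lt_or_ge (wordLength S g) (k + 1) with hlt | hge
    · exact Or.inl (Nat.lt_succ_iff.1 hlt)
    · right
      obtain ⟨h, hadj, hh⟩ := exists_adj_wordLength hS (le_antisymm hg hge)
      refine ⟨h, hh.le, h⁻¹ * g, ?_, by simp⟩
      rcases ((mulCayley_adj S g h).1 hadj).2 with h' | h'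
      · exact Or.inr (by simpa using h')
      · exact Or.inl h'

/-- Every element of `S(n, r)^∞` is linked, inside the annulus, to an element of any prescribed
length between `n` and `n + r`: follow a geodesic towards the identity to go down, and a path
towards infinity to go up. -/
theorem exists_linked_wordLength_eq (hS : (mulCayley S).Connected) (hfin : S.Finite) {n r k : ℕ}
    (hk : k ≤ r) {g : G} (hg : g ∈ annulusInf S n r) :
    ∃ h, wordLength S h = n + k ∧ Linked S (annulus S n (n + r)) g h := by
  rcases Nat.lt_or_ge (wordLength S g) (n + k) with hlt | hge
  · obtain ⟨f, hf, hf'⟩ := Set.Infinite.exists_notMem_finite (s := outerComponent S n g) hg.2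
      (finite_ball hS hfin (n + k))
    have hlink := (mem_outerComponent_iff.1 hf).2
    have hf' : n + k < wordLength S f := by simpa using hf'
    have main : ∀ a, Linked S (outerSet S n) g a →
        (wordLength S a < n + k ∧ Linked S (annulus S n (n + r)) g a) ∨
        ∃ h, wordLength S h = n + k ∧ Linked S (annulus S n (n + r)) g h := by
      intro a ha
      induction ha with
      | refl => exact Or.inl ⟨hlt, Linked.refl _⟩
      | @tail b c _ hbc ih =>
        rcases ih with ⟨hb, hgb⟩ | h
        · have hle := wordLength_le_succ hS hbc.1
          have hgc : Linked S (annulus S n (n + r)) g c :=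
            hgb.trans (Linked.of_adj hbc.1 ⟨hbc.2.1, by omega⟩ ⟨hbc.2.2, by omega⟩)
          rcases Nat.lt_or_ge (wordLength S c) (n + k) with h | h
          · exact Or.inl ⟨h, hgc⟩
          · exact Or.inr ⟨c, by omega, hgc⟩
        · exact Or.inr h
    rcases main f hlink with h | h
    · omega
    · exact h
  · have main : ∀ m, ∀ a : G, wordLength S a = n + k + m → n + k + m ≤ n + r →
        ∃ h, wordLength S h = n + k ∧ Linked S (annulus S n (n + r)) a h := by
      intro m
      induction m with
      | zero => exact fun a ha _ => ⟨a, ha, Linked.refl _⟩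
      | succ m ih =>
        intro a ha hm
        obtain ⟨b, hab, hb⟩ := exists_adj_wordLength hS (k := n + k + m) ha
        obtain ⟨h, hh, hbh⟩ := ih b hb (by omega)
        have hab' : Linked S (annulus S n (n + r)) a b :=
          Linked.of_adj hab ⟨by omega, by omega⟩ ⟨by omega, by omega⟩
        exact ⟨h, hh, hab'.trans hbh⟩
    have hle : wordLength S g ≤ n + r := hg.1
    exact main (wordLength S g - (n + k)) g (by omega) (by omega)

/-- A function which vanishes only at the identity, varies by at most one along each edge and
decreases along some edge at every other element is the word length. -/
theorem wordLength_eq_of_descent {F : G → ℕ} (h_one : F 1 = 0) (h_zero : ∀ g, F g = 0 → g = 1)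
    (h_lip : ∀ g h, (mulCayley S).Adj g h → F h ≤ F g + 1)
    (h_desc : ∀ g k, F g = k + 1 → ∃ h, (mulCayley S).Adj g h ∧ F h = k) :
    (mulCayley S).Connected ∧ Subgroup.closure S = ⊤ ∧ ∀ g, wordLength S g = F g := by
  have walk : ∀ k g, F g = k → ∃ w : (mulCayley S).Walk 1 g, w.length ≤ k := by
    intro k
    induction k with
    | zero =>
      intro g hg
      obtain rfl := h_zero g hg
      exact ⟨Walk.nil, by simp⟩
    | succ k ih =>
      intro g hg
      obtain ⟨h, hadj, hh⟩ := h_desc g k hg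
      obtain ⟨w, hw⟩ := ih h hh
      exact ⟨w.concat hadj.symm, by simpa using hw⟩
  have conn : (mulCayley S).Connected := by
    refine Connected.mk fun g h => ?_
    obtain ⟨w, -⟩ := walk _ g rfl
    obtain ⟨w', -⟩ := walk _ h rfl
    exact (w.reverse.append w').reachable
  refine ⟨conn, ?_, fun g => le_antisymm ?_ ?_⟩
  · refine eq_top_iff.2 fun g _ => ?_
    induction hk : F g generalizing g with
    | zero => rw [h_zero g hk]; exact one_mem _
    | succ k ih =>
      obtain ⟨h, hadj, hh⟩ := h_desc g k hk
      have hmem : h⁻¹ * g ∈ Subgroup.closure S := by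
        rcases ((mulCayley_adj S g h).1 hadj).2 with h' | h'
        · simpa using inv_mem (Subgroup.subset_closure h')
        · exact Subgroup.subset_closure h'
      simpa using mul_mem (ih h trivial hh) hmem
  · obtain ⟨w, hw⟩ := walk _ g rfl
    exact (dist_le w).trans hw
  · induction hk : wordLength S g generalizing g with
    | zero => rw [eq_one_of_wordLength_eq_zero conn hk, h_one]
    | succ k ih =>
      obtain ⟨h, hadj, hh⟩ := exists_adj_wordLength conn hk
      have := h_lip h g hadj.symm
      have := ih h hh
      omega

/-- An involution of the vertices which fixes the identity and respects adjacency preserves the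
word length. -/
theorem wordLength_involution (hS : (mulCayley S).Connected) {φ : G → G} (h_one : φ 1 = 1)
    (hφ : ∀ a b, (mulCayley S).Adj a b → (mulCayley S).Adj (φ a) (φ b))
    (h_inv : ∀ a, φ (φ a) = a) (g : G) : wordLength S (φ g) = wordLength S g := by
  have key : ∀ k g, wordLength S g = k → wordLength S (φ g) ≤ k := by
    intro k
    induction k with
    | zero =>
      intro g hg
      rw [eq_one_of_wordLength_eq_zero hS hg, h_one, wordLength_one]
    | succ k ih =>
      intro g hg
      obtain ⟨h, hadj, hh⟩ := exists_adj_wordLength hS hg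
      have := wordLength_le_succ hS (hφ _ _ hadj.symm)
      have := ih h hh
      omega
  refine le_antisymm (key _ g rfl) ?_
  have := key _ (φ g) rfl
  rwa [h_inv] at this

theorem infinitePart_involution {φ : G → G}
    (hφ : ∀ a b, (mulCayley S).Adj a b → (mulCayley S).Adj (φ a) (φ b))
    (h_inv : ∀ a, φ (φ a) = a) (h_len : ∀ a, wordLength S (φ a) = wordLength S a) {n : ℕ} {g : G}
    (hg : g ∈ infinitePart S n) : φ g ∈ infinitePart S n := by
  have hinj : Function.Injective φ := Function.LeftInverse.injective h_inv
  have hout : ∀ a ∈ outerSet S n, φ a ∈ outerSet S n := fun a ha => by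
    simpa [outerSet, h_len] using ha
  refine Set.Infinite.mono ?_ (Set.Infinite.image hinj.injOn hg)
  rintro _ ⟨h, hh, rfl⟩
  rw [mem_outerComponent_iff] at hh ⊢
  exact ⟨hout _ hh.1, hh.2.map hφ hout⟩

end Cayley

namespace Lamplighter

open SimpleGraph

/-! ### Configurations on the ladder: modification, hull, reflection -/

variable {L : Type*} [Group L]

/-- The finite set of the lit lamps. -/
noncomputable def lit (g : Lamplighter (ℤ × ZMod 2) L) : Finset (ℤ × ZMod 2) :=
  g.finite_mulSupport.toFinset

@[simp] theorem mem_lit {g : Lamplighter (ℤ × ZMod 2) L} {v : ℤ × ZMod 2} :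
    v ∈ g.lit ↔ g.lamp v ≠ 1 := by simp [lit]

/-- Move to `p` and give the lamps of the finite set `T` the states prescribed by `f`. -/
noncomputable def modify (g : Lamplighter (ℤ × ZMod 2) L) (p : ℤ × ZMod 2)
    (T : Finset (ℤ × ZMod 2)) (f : ℤ × ZMod 2 → L) : Lamplighter (ℤ × ZMod 2) L where
  pos := p
  lamp v := if v ∈ T then f v else g.lamp v
  finite_mulSupport := by
    refine (T.finite_toSet.union g.finite_mulSupport).subset fun v hv => ?_
    by_cases h : v ∈ T
    · exact Or.inl h
    · exact Or.inr (by simpa [h] using hv)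

@[simp] theorem modify_pos (g : Lamplighter (ℤ × ZMod 2) L) (p T f) :
    (g.modify p T f).pos = p := rfl

theorem modify_lamp (g : Lamplighter (ℤ × ZMod 2) L) (p T f v) :
    (g.modify p T f).lamp v = if v ∈ T then f v else g.lamp v := rfl

/-- The vertices of the ladder whose column lies between `x` and `c`. -/
noncomputable def columns (x c : ℤ) : Finset (ℤ × ZMod 2) := Finset.Icc x c ×ˢ Finset.univ

@[simp] theorem mem_columns {x c : ℤ} {v : ℤ × ZMod 2} :
    v ∈ columns x c ↔ x ≤ v.1 ∧ v.1 ≤ c := by simp [columns]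

/-- The rightmost column among that of the origin, that of the position and those of the lit
lamps. -/
noncomputable def reach (g : Lamplighter (ℤ × ZMod 2) L) : ℤ :=
  (insert 0 (insert g.pos.1 (g.lit.image Prod.fst))).max' (Finset.insert_nonempty _ _)

theorem reach_le_iff {g : Lamplighter (ℤ × ZMod 2) L} {m : ℤ} :
    g.reach ≤ m ↔ 0 ≤ m ∧ g.pos.1 ≤ m ∧ ∀ v, g.lamp v ≠ 1 → v.1 ≤ m := by
  rw [reach, Finset.max'_le_iff]
  simp only [Finset.mem_insert, Finset.mem_image, mem_lit]
  constructor
  · intro h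
    exact ⟨h _ (Or.inl rfl), h _ (Or.inr (Or.inl rfl)),
      fun v hv => h _ (Or.inr (Or.inr ⟨v, hv, rfl⟩))⟩
  · rintro ⟨h₁, h₂, h₃⟩ y (rfl | rfl | ⟨v, hv, rfl⟩)
    exacts [h₁, h₂, h₃ v hv]

theorem reach_nonneg (g : Lamplighter (ℤ × ZMod 2) L) : 0 ≤ g.reach :=
  (reach_le_iff.1 le_rfl).1

theorem pos_le_reach (g : Lamplighter (ℤ × ZMod 2) L) : g.pos.1 ≤ g.reach :=
  (reach_le_iff.1 le_rfl).2.1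

theorem le_reach {g : Lamplighter (ℤ × ZMod 2) L} {v : ℤ × ZMod 2} (hv : g.lamp v ≠ 1) :
    v.1 ≤ g.reach :=
  (reach_le_iff.1 le_rfl).2.2 v hv

theorem lamp_eq_one_of_reach_lt {g : Lamplighter (ℤ × ZMod 2) L} {v : ℤ × ZMod 2}
    (hv : g.reach < v.1) : g.lamp v = 1 := by
  by_contra h
  exact absurd (le_reach h) (by omega)

/-- The maximum defining `reach` is attained. -/
theorem reach_attained (g : Lamplighter (ℤ × ZMod 2) L) :
    g.reach = 0 ∨ g.reach = g.pos.1 ∨ ∃ v, g.lamp v ≠ 1 ∧ v.1 = g.reach := by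
  have h := Finset.max'_mem (insert 0 (insert g.pos.1 (g.lit.image Prod.fst)))
    (Finset.insert_nonempty _ _)
  simp only [Finset.mem_insert, Finset.mem_image, mem_lit] at h
  exact h

/-- The reflection of the ladder which reverses the first coordinate. -/
def flip (v : ℤ × ZMod 2) : ℤ × ZMod 2 := (-v.1, v.2)

@[simp] theorem flip_flip (v : ℤ × ZMod 2) : flip (flip v) = v := by simp [flip]

@[simp] theorem flip_fst (v : ℤ × ZMod 2) : (flip v).1 = -v.1 := rfl

@[simp] theorem flip_snd (v : ℤ × ZMod 2) : (flip v).2 = v.2 := rfl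

/-- The reflection of positions and lamps under which the ladder is reversed. -/
def mirror (g : Lamplighter (ℤ × ZMod 2) L) : Lamplighter (ℤ × ZMod 2) L where
  pos := flip g.pos
  lamp v := g.lamp (flip v)
  finite_mulSupport :=
    g.finite_mulSupport.preimage (Function.LeftInverse.injective flip_flip).injOn

@[simp] theorem mirror_pos (g : Lamplighter (ℤ × ZMod 2) L) : g.mirror.pos = flip g.pos := rfl

@[simp] theorem mirror_lamp (g : Lamplighter (ℤ × ZMod 2) L) (v) :
    g.mirror.lamp v = g.lamp (flip v) := rfl

@[simp] theorem mirror_mirror (g : Lamplighter (ℤ × ZMod 2) L) : g.mirror.mirror = g := by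
  ext v <;> simp

@[simp] theorem mirror_one : (1 : Lamplighter (ℤ × ZMod 2) L).mirror = 1 := by
  ext v <;> simp

theorem zmod_two_cases (ε : ZMod 2) : ε = 0 ∨ ε = 1 := by revert ε; decide

/-! ### Adjacency in the two Cayley graphs -/

/-- Adjacency in the ladder `ℤ × ℤ₂`. -/
def LadderAdj (p q : ℤ × ZMod 2) : Prop :=
  (p.1 = q.1 ∧ p.2 ≠ q.2) ∨ ((q.1 = p.1 + 1 ∨ p.1 = q.1 + 1) ∧ p.2 = q.2)

theorem LadderAdj.symm {p q : ℤ × ZMod 2} (h : LadderAdj p q) : LadderAdj q p := by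
  rcases h with ⟨h₁, h₂⟩ | ⟨h₁, h₂⟩
  · exact Or.inl ⟨h₁.symm, h₂.symm⟩
  · exact Or.inr ⟨h₁.symm, h₂.symm⟩

theorem LadderAdj.ne {p q : ℤ × ZMod 2} (h : LadderAdj p q) : p ≠ q := by
  rintro rfl
  rcases h with ⟨-, h₂⟩ | ⟨h₁, -⟩
  · exact h₂ rfl
  · omega

theorem mem_ladderGenerators_iff {s : Lamplighter (ℤ × ZMod 2) L} :
    s ∈ ladderGenerators L ↔ LadderAdj 0 s.pos ∧ ∀ v, v ≠ 0 → v ≠ s.pos → s.lamp v = 1 := by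
  constructor
  · rintro ⟨l, m, w, hw, rfl⟩
    have hw' : LadderAdj 0 w := by
      rcases hw with rfl | rfl | rfl <;> simp [LadderAdj]
    refine ⟨by simpa [switchAt, walk] using hw', fun v hv hv' => ?_⟩
    have hv'' : v ≠ w := by simpa [switchAt, walk] using hv'
    have : -w + v ≠ 0 := by
      intro h
      exact hv'' (by rw [neg_add_eq_zero] at h; exact h.symm)
    simp [switchAt, walk, hv, this]
  · rintro ⟨hadj, hlamp⟩
    refine ⟨s.lamp 0, s.lamp s.pos, s.pos, ?_, ?_⟩
    · obtain ⟨⟨a, ε⟩, f, hf⟩ := s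
      rcases zmod_two_cases ε with rfl | rfl
      · simp [LadderAdj] at hadj
        simp
        omega
      · simp [LadderAdj] at hadj
        simp [← hadj]
    · have hne := hadj.ne
      ext v
      · simp [switchAt, walk]
      · simp [switchAt, walk]
      · by_cases hv : v = 0
        · subst hv
          simp [switchAt, walk, hne.symm]
        · by_cases hv' : v = s.pos
          · subst hv'
            simp [switchAt, walk, hv]
          · have : -s.pos + v ≠ 0 := by
              intro h
              exact hv' (by rw [neg_add_eq_zero] at h; exact h.symm)
            simp [switchAt, walk, hv, this, hlamp v hv hv']

theorem ladder_adj_iff {g h : Lamplighter (ℤ × ZMod 2) L} :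
    (mulCayley (ladderGenerators L)).Adj g h ↔
      LadderAdj g.pos h.pos ∧ ∀ v, v ≠ g.pos → v ≠ h.pos → g.lamp v = h.lamp v := by
  have key : ∀ g h : Lamplighter (ℤ × ZMod 2) L, g⁻¹ * h ∈ ladderGenerators L ↔
      LadderAdj g.pos h.pos ∧ ∀ v, v ≠ g.pos → v ≠ h.pos → g.lamp v = h.lamp v := by
    intro g h
    rw [mem_ladderGenerators_iff]
    refine and_congr ?_ ⟨fun H v hv hv' => ?_, fun H v hv hv' => ?_⟩
    · simp only [LadderAdj, mul_pos', inv_pos', Prod.fst_zero, Prod.snd_zero, Prod.fst_add,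
        Prod.snd_add, Prod.fst_neg, Prod.snd_neg, ne_eq]
      have h1 : (0 = -g.pos.2 + h.pos.2) ↔ g.pos.2 = h.pos.2 := by
        rw [eq_comm, neg_add_eq_zero]
      rw [h1]
      constructor <;> rintro (⟨a, b⟩ | ⟨a, b⟩)
      · exact Or.inl ⟨by omega, b⟩
      · exact Or.inr ⟨by omega, b⟩
      · exact Or.inl ⟨by omega, b⟩
      · exact Or.inr ⟨by omega, b⟩
    · have := H (-g.pos + v) (fun h0 => hv ?_) (fun h0 => hv' ?_)
      · simpa [inv_mul_eq_one] using this
      · rw [neg_add_eq_zero] at h0; exact h0.symm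
      · simpa using h0
    · have := H (g.pos + v) (by simpa using hv) (fun h0 => hv' (by simp [← h0]))
      simp [this]
  rw [mulCayley_adj, key, key]
  constructor
  · rintro ⟨-, H | H⟩
    · exact H
    · exact ⟨H.1.symm, fun v hv hv' => (H.2 v hv' hv).symm⟩
  · intro H
    exact ⟨fun h => H.1.ne (by rw [h]), Or.inl H⟩

theorem switchBoth_lamp (l l' : L) (v : ℤ × ZMod 2) :
    (switchBoth l l').lamp v = if v = (0, 0) then l else if v = (0, 1) then l' else 1 := by
  have h01 : ((0 : ℤ), (0 : ZMod 2)) ≠ (0, 1) := by simp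
  by_cases h : v = (0, 0)
  · subst h; simp [switchBoth, switchAt]
  · by_cases h' : v = (0, 1)
    · subst h'; simp [switchBoth, switchAt]
    · simp [switchBoth, switchAt, h, h']

@[simp] theorem switchBoth_pos (l l' : L) : (switchBoth l l').pos = 0 := by
  simp [switchBoth, switchAt]

theorem mem_doubleSwitchGenerators_iff {s : Lamplighter (ℤ × ZMod 2) L} :
    s ∈ doubleSwitchGenerators L ↔
      (s.pos.1 = 1 ∨ s.pos.1 = -1) ∧ ∀ v, v.1 ≠ 0 → v.1 ≠ s.pos.1 → s.lamp v = 1 := by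
  constructor
  · rintro ⟨l, l', m, m', w, hw, rfl⟩
    refine ⟨by simpa [walk] using hw, fun v hv hv' => ?_⟩
    have hv'' : v.1 ≠ w.1 := by simpa [walk] using hv'
    have h1 : ∀ ε : ZMod 2, v ≠ (0, ε) := fun ε h => hv (by rw [h])
    have h2 : ∀ ε : ZMod 2, -w + v ≠ (0, ε) := fun ε h => hv'' (by
      have := congrArg Prod.fst h
      simp at this
      omega)
    simp [walk, switchBoth_lamp, h1, h2]
  · rintro ⟨hpos, hlamp⟩
    obtain ⟨⟨x, δ⟩, f, hf⟩ := s
    simp only at hpos hlamp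
    refine ⟨f (0, 0), f (0, 1), f (x, δ), f (x, δ + 1), (x, δ), hpos, ?_⟩
    ext v
    · simp [walk]
    · simp [walk]
    · simp only [mul_lamp, switchBoth_lamp, walk, mul_pos', switchBoth_pos, zero_add]
      have e0 : ∀ ε : ZMod 2, (-(x, δ) + v = (0, ε)) ↔ v = (x, δ + ε) := by
        intro ε
        rw [neg_add_eq_iff_eq_add]
        constructor <;> rintro rfl <;> ext <;> simp
      simp only [e0]
      clear e0
      obtain ⟨a, ε⟩ := v
      by_cases ha : a = 0
      · subst ha
        have hne : (0 : ℤ) ≠ x := by omega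
        rcases zmod_two_cases ε with rfl | rfl <;> simp [hne]
      · by_cases ha' : a = x
        · subst ha'
          have h2 : ε = δ ∨ ε = δ + 1 := by
            clear hlamp hf
            revert ε δ; decide
          rcases h2 with rfl | rfl <;> simp [ha]
        · simp [ha, ha', hlamp (a, ε) ha ha']

theorem double_adj_iff {g h : Lamplighter (ℤ × ZMod 2) L} :
    (mulCayley (doubleSwitchGenerators L)).Adj g h ↔
      (h.pos.1 = g.pos.1 + 1 ∨ g.pos.1 = h.pos.1 + 1) ∧
        ∀ v : ℤ × ZMod 2, v.1 ≠ g.pos.1 → v.1 ≠ h.pos.1 → g.lamp v = h.lamp v := by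
  have key : ∀ g h : Lamplighter (ℤ × ZMod 2) L, g⁻¹ * h ∈ doubleSwitchGenerators L ↔
      (h.pos.1 = g.pos.1 + 1 ∨ g.pos.1 = h.pos.1 + 1) ∧
        ∀ v : ℤ × ZMod 2, v.1 ≠ g.pos.1 → v.1 ≠ h.pos.1 → g.lamp v = h.lamp v := by
    intro g h
    rw [mem_doubleSwitchGenerators_iff]
    refine and_congr ?_ ⟨fun H v hv hv' => ?_, fun H v hv hv' => ?_⟩
    · simp only [mul_pos', inv_pos', Prod.fst_add, Prod.fst_neg]
      omega
    · have := H (-g.pos + v) (fun h0 => hv ?_) (fun h0 => hv' ?_)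
      · simpa [inv_mul_eq_one] using this
      · simp only [Prod.fst_add, Prod.fst_neg] at h0
        omega
      · simpa using h0
    · have := H (g.pos + v) (by simpa using hv) (fun h0 => hv' (by simp [← h0]))
      simp [this]
  rw [mulCayley_adj, key, key]
  constructor
  · rintro ⟨-, H | H⟩
    · exact H
    · exact ⟨H.1.symm, fun v hv hv' => (H.2 v hv' hv).symm⟩
  · intro H
    refine ⟨?_, Or.inl H⟩
    rintro rfl
    have := H.1
    omega

theorem ladder_adj_mirror (g h : Lamplighter (ℤ × ZMod 2) L)
    (H : (mulCayley (ladderGenerators L)).Adj g h) :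
    (mulCayley (ladderGenerators L)).Adj g.mirror h.mirror := by
  rw [ladder_adj_iff] at H ⊢
  refine ⟨?_, fun v hv hv' => H.2 _ (fun h0 => hv ?_) (fun h0 => hv' ?_)⟩
  · rcases H.1 with ⟨h₁, h₂⟩ | ⟨h₁, h₂⟩
    · exact Or.inl ⟨by simp [h₁], h₂⟩
    · refine Or.inr ⟨?_, h₂⟩
      simp only [mirror_pos, flip_fst]
      omega
  · simp [← h0]
  · simp [← h0]

theorem double_adj_mirror (g h : Lamplighter (ℤ × ZMod 2) L)
    (H : (mulCayley (doubleSwitchGenerators L)).Adj g h) :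
    (mulCayley (doubleSwitchGenerators L)).Adj g.mirror h.mirror := by
  rw [double_adj_iff] at H ⊢
  refine ⟨?_, fun v hv hv' => H.2 _ (fun h0 => hv ?_) (fun h0 => hv' ?_)⟩
  · simp only [mirror_pos, flip_fst]
    omega
  · simp only [mirror_pos, flip_fst] at h0 ⊢
    omega
  · simp only [mirror_pos, flip_fst] at h0 ⊢
    omega

theorem finite_ladderGenerators [Finite L] : (ladderGenerators L).Finite := by
  have : ladderGenerators L ⊆ (fun t : L × L × (ℤ × ZMod 2) =>
      switchAt 0 t.1 * walk t.2.2 * switchAt 0 t.2.1) ''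
      (Set.univ ×ˢ Set.univ ×ˢ {(1, 0), (-1, 0), (0, 1)}) := by
    rintro g ⟨l, m, w, hw, rfl⟩
    exact ⟨(l, m, w), by simpa using hw, rfl⟩
  refine Set.Finite.subset (Set.Finite.image _ ?_) this
  exact Set.finite_univ.prod (Set.finite_univ.prod (by simp))

theorem finite_doubleSwitchGenerators [Finite L] : (doubleSwitchGenerators L).Finite := by
  have : doubleSwitchGenerators L ⊆ (fun t : (L × L) × (L × L) × (ℤ × ZMod 2) =>
      switchBoth t.1.1 t.1.2 * walk t.2.2 * switchBoth t.2.1.1 t.2.1.2) ''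
      (Set.univ ×ˢ Set.univ ×ˢ ({1, -1} ×ˢ Set.univ)) := by
    rintro g ⟨l, l', m, m', w, hw, rfl⟩
    exact ⟨((l, l'), (m, m'), w), by simpa using hw, rfl⟩
  refine Set.Finite.subset (Set.Finite.image _ ?_) this
  exact Set.finite_univ.prod (Set.finite_univ.prod ((by simp : ({1, -1} : Set ℤ).Finite).prod
    Set.finite_univ))

end Lamplighter

/-! ### Covering tours of the ladder -/

namespace Lamplighter

open SimpleGraph

/-- `Tour k p V`: some walk of at most `k` steps in the ladder leads from the origin to `p` and
has each vertex of `V` as an endpoint of one of its steps. A walk without steps thus covers nothing,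
not even the origin: with switch-walk-switch generators, lamps are switched only along with a
step. -/
inductive Tour : ℕ → ℤ × ZMod 2 → Finset (ℤ × ZMod 2) → Prop
  | nil : Tour 0 0 ∅
  | stay {k p V} : Tour k p V → Tour (k + 1) p V
  | step {k p q V V'} : Tour k p V → LadderAdj p q → V' ⊆ insert p (insert q V) →
      Tour (k + 1) q V'

namespace Tour

variable {k : ℕ} {p q : ℤ × ZMod 2} {V W : Finset (ℤ × ZMod 2)} {c : ℤ} {ε : ZMod 2}

theorem mono (H : Tour k p V) (h : W ⊆ V) : Tour k p W := by
  induction H generalizing W with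
  | nil => rw [Finset.subset_empty.1 h]; exact nil
  | stay _ ih => exact (ih h).stay
  | step H hadj hV _ => exact H.step hadj (h.trans hV)

theorem le {k' : ℕ} (H : Tour k p V) (h : k ≤ k') : Tour k' p V := by
  induction h with
  | refl => exact H
  | step _ ih => exact ih.stay

theorem insert_end (H : Tour k p V) (hp : p ≠ 0) : Tour k p (insert p V) := by
  induction H with
  | nil => exact absurd rfl hp
  | stay _ ih => exact (ih hp).stay
  | step H hadj hV _ =>
    refine H.step hadj ?_
    intro v hv
    rcases Finset.mem_insert.1 hv with rfl | hv
    · simp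
    · exact hV hv

theorem col_le (H : Tour k p V) : p.1 ≤ k ∧ ∀ v ∈ V, v.1 ≤ k := by
  induction H with
  | nil => simp
  | stay _ ih =>
    push_cast
    exact ⟨by omega, fun v hv => by have := ih.2 v hv; omega⟩
  | @step k p q V V' _ hadj hV ih =>
    have hq : q.1 ≤ p.1 + 1 := by rcases hadj with ⟨h, -⟩ | ⟨h, -⟩ <;> omega
    push_cast
    refine ⟨by omega, fun v hv => ?_⟩
    rcases Finset.mem_insert.1 (hV hv) with rfl | hv
    · omega
    · rcases Finset.mem_insert.1 hv with rfl | hv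
      · omega
      · have := ih.2 v hv
        omega

theorem vertical_adj (c : ℤ) (ε : ZMod 2) : LadderAdj (c, ε) (c, ε + 1) :=
  Or.inl ⟨rfl, by simp⟩

theorem right_adj (c : ℤ) (ε : ZMod 2) : LadderAdj (c, ε) (c + 1, ε) :=
  Or.inr ⟨Or.inl rfl, rfl⟩

theorem eq_or_eq_of_fst {v : ℤ × ZMod 2} (ε : ZMod 2) (h : v.1 = c) :
    v = (c, ε) ∨ v = (c, ε + 1) := by
  obtain ⟨a, δ⟩ := v
  subst h
  have : ∀ δ ε : ZMod 2, δ = ε ∨ δ = ε + 1 := by decide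
  rcases this δ ε with rfl | rfl <;> simp

theorem change_row (H : Tour k (c, ε) V) (ε' : ZMod 2) : Tour (k + 1) (c, ε') V := by
  by_cases h : ε = ε'
  · subst h; exact H.stay
  · exact H.step (Or.inl ⟨rfl, h⟩) fun v hv => by simp [hv]

/-- Going `s` columns to the right along one row and back along the other one. -/
theorem loop (s : ℕ) (H : Tour k (c, ε) V)
    (hW : ∀ v ∈ W, v ∈ V ∨ (c ≤ v.1 ∧ v.1 ≤ c + s)) : Tour (k + 2 * s + 1) (c, ε + 1) W := by
  induction s generalizing c k V W with
  | zero =>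
    refine H.step (vertical_adj c ε) fun v hv => ?_
    rcases hW v hv with h | h
    · simp [h]
    · rcases eq_or_eq_of_fst (c := c) (v := v) ε (by push_cast at h; omega) with rfl | rfl <;> simp
  | succ s ih =>
    have h₁ : Tour (k + 1) (c + 1, ε) (insert (c, ε) V) :=
      H.step (right_adj c ε) (Finset.insert_subset_insert _ (Finset.subset_insert _ _))
    have h₂ := ih (W := W.filter (· ≠ (c, ε + 1))) h₁ (fun v hv => by
      rw [Finset.mem_filter] at hv
      rcases hW v hv.1 with h | h
      · simp [h]
      · by_cases hc : v.1 = c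
        · rcases eq_or_eq_of_fst ε hc with rfl | rfl
          · simp
          · exact absurd rfl hv.2
        · push_cast at h
          right; omega)
    have h₃ := h₂.step (V' := W) (right_adj c (ε + 1)).symm (fun v hv => by
      by_cases hc : v = (c, ε + 1)
      · simp [hc]
      · simp [hc, hv])
    exact h₃.le (by omega)

/-- Going `t` columns to the right while visiting both rows of each column. -/
theorem zigzag (t : ℕ) (H : Tour k (c, ε) V)
    (hW : ∀ v ∈ W, v ∈ V ∨ (c ≤ v.1 ∧ v.1 ≤ c + t)) :
    ∃ ε', Tour (k + 2 * t + 1) (c + t, ε') W := by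
  induction t generalizing W with
  | zero => exact ⟨ε + 1, by simpa using H.loop 0 hW⟩
  | succ t ih =>
    obtain ⟨ε', h₁⟩ := ih (W := W.filter fun v => v ∈ V ∨ v.1 ≤ c + t) (fun v hv => by
      rw [Finset.mem_filter] at hv
      rcases hv.2 with h | h
      · exact Or.inl h
      · rcases hW v hv.1 with h' | h'
        · exact Or.inl h'
        · exact Or.inr ⟨h'.1, h⟩)
    have h₂ := h₁.step (right_adj _ _) (Finset.Subset.refl _)
    refine ⟨ε' + 1, ?_⟩
    have h₃ := h₂.loop 0 (W := W) (fun v hv => by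
      by_cases hc : v ∈ V ∨ v.1 ≤ c + t
      · left; simp [hv, hc]
      · right
        rcases hW v hv with h | h
        · exact absurd (Or.inl h) hc
        · push_cast at h ⊢
          rw [not_or] at hc
          omega)
    have h₄ := h₃.le (k' := k + 2 * (t + 1) + 1) (by omega)
    push_cast
    rwa [← add_assoc]

/-- Two more steps suffice to cover one more vertex next to the covered ones, the origin or the
endpoint. -/
theorem detour (H : Tour k p V) {v w : ℤ × ZMod 2} (hv : v = 0 ∨ v = p ∨ v ∈ V)
    (hvw : v = w ∨ LadderAdj v w) : Tour (k + 2) p (insert w V) := by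
  have here : ∀ {k q V}, Tour k q V → (q = w ∨ LadderAdj q w) → Tour (k + 2) q (insert w V) := by
    rintro k q V H (rfl | hadj)
    · have hadj := vertical_adj q.1 q.2
      exact (H.step hadj (Finset.Subset.refl _)).step hadj.symm (fun u hu => by
        rcases Finset.mem_insert.1 hu with rfl | hu <;> simp [*])
    · exact (H.step hadj (Finset.Subset.refl _)).step hadj.symm (fun u hu => by
        rcases Finset.mem_insert.1 hu with rfl | hu <;> simp [*])
  induction H with
  | nil =>
    have : v = 0 := by simpa using hv
    subst this
    exact here nil hvw
  | stay _ ih => exact (ih hv).stay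
  | @step k p q V V' H hadj hV ih =>
    by_cases hq : v = q
    · subst hq
      exact here (H.step hadj hV) hvw
    · have h₁ : v = 0 ∨ v = p ∨ v ∈ V := by
        rcases hv with h | h | h
        · exact Or.inl h
        · exact absurd h hq
        · have := hV h
          simp only [Finset.mem_insert] at this
          tauto
      refine (ih h₁).step hadj fun u hu => ?_
      rcases Finset.mem_insert.1 hu with rfl | hu
      · simp
      · have := hV hu
        simp only [Finset.mem_insert] at this ⊢
        tauto

/-- Truncating a tour at the column `x ≥ 0`: the excursions to the right of this column are removed,
and replaced by at most one vertical step each. The steps saved are at least as many as the vertices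
covered to the right of `x`, and, when `B` is the rightmost column visited, nearly twice `B - x` if
the tour ends to the left. The truncation may have no steps when `x = 0`, which is why its covering
of the column `x` is asserted for `0 < x` only. -/
theorem trunc (H : Tour k p V) {x : ℤ} (hx : 0 ≤ x) : ∃ (k' : ℕ) (ε : ZMod 2) (B : ℤ),
    Tour k' (min p.1 x, ε) (V.filter fun v => v.1 < x ∨ (v.1 = x ∧ 0 < x)) ∧
    (p.1 ≤ x → ε = p.2) ∧ k' + ((insert p V).filter (x < ·.1)).card ≤ k ∧
    (∀ v ∈ V, v.1 ≤ B) ∧ x ≤ B ∧ p.1 ≤ B ∧ (p.1 ≤ x → (k' : ℤ) + 2 * (B - x) - 1 ≤ k) ∧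
    (x < p.1 → (k' : ℤ) + (B - x) + (B - p.1) ≤ k) := by
  induction H with
  | nil =>
    refine ⟨0, 0, x, ?_, fun _ => rfl, ?_, by simp, le_rfl, hx, by simp, fun h => ?_⟩
    · have : (min (0 : ℤ × ZMod 2).1 x, (0 : ZMod 2)) = 0 := by
        ext <;> simp [hx]
      rw [this]
      exact nil
    · rw [Finset.card_eq_zero.2]
      ext v
      simp only [Finset.mem_filter, Finset.mem_insert, Finset.notMem_empty, or_false, iff_false,
        not_and, not_lt]
      rintro rfl
      exact hx
    · have : (0 : ℤ × ZMod 2).1 = 0 := rfl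
      omega
  | stay _ ih =>
    obtain ⟨k', ε, B, h₁, h₂, h₃, h₄, h₅, h₆, h₇, h₈⟩ := ih
    push_cast
    exact ⟨k', ε, B, h₁, h₂, by omega, h₄, h₅, h₆, fun h => by have := h₇ h; omega,
      fun h => by have := h₈ h; omega⟩
  | @step k p q V V' _ hadj hV ih =>
    obtain ⟨k', ε, B, h₁, h₂, h₃, h₄, h₅, h₆, h₇, h₈⟩ := ih
    have hVB : ∀ v ∈ V', v.1 ≤ max B q.1 := by
      intro v hv
      have := hV hv
      simp only [Finset.mem_insert] at this
      rcases this with rfl | rfl | h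
      · exact le_max_of_le_left h₆
      · exact le_max_right _ _
      · exact le_max_of_le_left (h₄ v h)
    have hsub : insert q V' ⊆ insert q (insert p V) := by
      refine Finset.insert_subset (Finset.mem_insert_self _ _) (hV.trans ?_)
      intro v hv
      simp only [Finset.mem_insert] at hv ⊢
      tauto
    have hcard : ((insert q V').filter (x < ·.1)).card ≤
        ((insert p V).filter (x < ·.1)).card + if x < q.1 then 1 else 0 := by
      refine (Finset.card_le_card (Finset.filter_subset_filter _ hsub)).trans ?_
      rw [Finset.filter_insert]
      split_ifs
      · exact Finset.card_insert_le _ _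
      · simp
    push_cast
    rcases lt_or_ge x q.1 with hq | hq
    · rw [if_pos hq] at hcard
      have hqx : min q.1 x = x := min_eq_right hq.le
      have hpx : min p.1 x = x := min_eq_right (by rcases hadj with ⟨h, -⟩ | ⟨h, -⟩ <;> omega)
      rw [hpx] at h₁
      refine ⟨k', ε, max B q.1, ?_, fun h => by omega, by omega, hVB, le_max_of_le_left h₅,
        le_max_right _ _, fun h => by omega, fun _ => ?_⟩
      · rw [hqx]
        have : Tour k' (x, ε) (if 0 < x then
            insert (x, ε) (V.filter fun v => v.1 < x ∨ (v.1 = x ∧ 0 < x))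
            else V.filter fun v => v.1 < x ∨ (v.1 = x ∧ 0 < x)) := by
          split_ifs with h0
          · refine h₁.insert_end fun h => ?_
            have := congrArg Prod.fst h
            simp at this
            omega
          · exact h₁
        refine this.mono fun v hv => ?_
        rw [Finset.mem_filter] at hv
        have hv' := hV hv.1
        simp only [Finset.mem_insert] at hv'
        rcases hv' with rfl | rfl | hv'
        · have h0 : 0 < x := by omega
          have : v = (x, ε) := by
            have := h₂ (by omega)
            ext
            · simp; omega
            · simp [this]
          rw [if_pos h0, this]
          simp
        · omega
        · split_ifs <;> simp [hv', hv.2]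
      · rcases lt_or_ge x p.1 with hp | hp
        · have := h₈ hp
          rcases hadj with ⟨h, -⟩ | ⟨h, -⟩ <;> omega
        · have := h₇ hp
          rcases hadj with ⟨h, -⟩ | ⟨h, -⟩ <;> omega
    · rw [if_neg (not_lt.2 hq)] at hcard
      have hqB : max B q.1 = B := max_eq_left (by omega)
      rw [hqB] at hVB
      have hqx : (min q.1 x, q.2) = q := by rw [min_eq_left hq]
      refine ⟨k' + 1, q.2, B, ?_, fun _ => rfl, by omega, hVB, h₅, by omega, fun _ => ?_,
        fun h => by omega⟩
      · rw [hqx]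
        rcases lt_or_ge x p.1 with hp | hp
        · have hqx' : q.1 = x := by rcases hadj with ⟨h, -⟩ | ⟨h, -⟩ <;> omega
          rw [min_eq_right hp.le] at h₁
          have hmove := h₁.change_row q.2
          have hq' : (x, q.2) = q := by rw [← hqx']
          rw [hq'] at hmove
          have : Tour (k' + 1) q (if 0 < x then
              insert q (V.filter fun v => v.1 < x ∨ (v.1 = x ∧ 0 < x))
              else V.filter fun v => v.1 < x ∨ (v.1 = x ∧ 0 < x)) := by
            split_ifs with h0
            · refine hmove.insert_end fun h => ?_
              have := congrArg Prod.fst h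
              simp at this
              omega
            · exact hmove
          refine this.mono fun v hv => ?_
          rw [Finset.mem_filter] at hv
          have hv' := hV hv.1
          simp only [Finset.mem_insert] at hv'
          rcases hv' with rfl | rfl | hv'
          · omega
          · rw [if_pos (by omega)]
            simp
          · split_ifs <;> simp [hv', hv.2]
        · have hp' : (min p.1 x, ε) = p := by rw [min_eq_left hp, h₂ hp]
          rw [hp'] at h₁
          refine h₁.step hadj fun v hv => ?_
          rw [Finset.mem_filter] at hv
          have hv' := hV hv.1
          simp only [Finset.mem_insert] at hv'
          rcases hv' with rfl | rfl | hv' <;> simp [*]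
      · push_cast
        rcases lt_or_ge x p.1 with hp | hp
        · have := h₈ hp
          rcases hadj with ⟨h, -⟩ | ⟨h, -⟩ <;> omega
        · have := h₇ hp
          omega

theorem exists_move (H : Tour k p V) (q : ℤ × ZMod 2) : ∃ k', Tour k' q V := by
  induction hm : (q.1 - p.1).natAbs generalizing k p with
  | zero =>
    obtain ⟨c, ε⟩ := p
    obtain ⟨c', ε'⟩ := q
    obtain rfl : c' = c := by simp only at hm; omega
    exact ⟨_, H.change_row ε'⟩
  | succ m ih =>
    have hsub : ∀ r, V ⊆ insert p (insert r V) := fun r v hv => by simp [hv]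
    rcases lt_or_ge p.1 q.1 with h | h
    · exact ih (p := (p.1 + 1, p.2)) (H.step (Or.inr ⟨Or.inl rfl, rfl⟩) (hsub _))
        (by simp only; omega)
    · exact ih (p := (p.1 - 1, p.2)) (H.step (Or.inr ⟨Or.inr (by simp), rfl⟩) (hsub _))
        (by simp only; omega)

theorem exists_tour (p : ℤ × ZMod 2) (V : Finset (ℤ × ZMod 2)) : ∃ k, Tour k p V := by
  induction V using Finset.induction_on generalizing p with
  | empty => exact nil.exists_move p
  | insert v V _ ih =>
    obtain ⟨k, H⟩ := ih v
    have hadj : LadderAdj v (v.1, v.2 + 1) := vertical_adj v.1 v.2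
    exact (H.step (V' := insert v V) hadj
      (Finset.insert_subset_insert _ (Finset.subset_insert _ _))).exists_move p

end Tour

variable {L : Type*} [Group L]

theorem Tour.of_adj {k : ℕ} {g h : Lamplighter (ℤ × ZMod 2) L}
    (hadj : (mulCayley (ladderGenerators L)).Adj g h) (H : Tour k g.pos g.lit) :
    Tour (k + 1) h.pos h.lit := by
  rw [ladder_adj_iff] at hadj
  refine H.step hadj.1 fun v hv => ?_
  simp only [Finset.mem_insert, mem_lit] at hv ⊢
  by_cases h₁ : v = g.pos
  · exact Or.inl h₁
  · by_cases h₂ : v = h.pos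
    · exact Or.inr (Or.inl h₂)
    · exact Or.inr (Or.inr (by rwa [hadj.2 v h₁ h₂]))

/-- The switch-walk-switch generators generate, and the word length is the length of a shortest
covering tour. -/
theorem ladder_metric (L : Type*) [Group L] :
    (mulCayley (ladderGenerators L)).Connected ∧ Subgroup.closure (ladderGenerators L) = ⊤ ∧
      ∀ (g : Lamplighter (ℤ × ZMod 2) L) (k : ℕ),
        wordLength (ladderGenerators L) g ≤ k ↔ Tour k g.pos g.lit := by
  classical
  let F : Lamplighter (ℤ × ZMod 2) L → ℕ := fun g => Nat.find (Tour.exists_tour g.pos g.lit)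
  have hF : ∀ g k, F g ≤ k ↔ Tour k g.pos g.lit := fun g k =>
    ⟨fun h => (Nat.find_spec (Tour.exists_tour g.pos g.lit)).le h, fun h => Nat.find_min' _ h⟩
  have h_lip : ∀ g h, (mulCayley (ladderGenerators L)).Adj g h → F h ≤ F g + 1 := fun g h hadj =>
    (hF _ _).2 (((hF g _).1 le_rfl).of_adj hadj)
  have := Cayley.wordLength_eq_of_descent (S := ladderGenerators L) (F := F) ?_ ?_ h_lip ?_
  · exact ⟨this.1, this.2.1, fun g k => by rw [this.2.2, hF]⟩
  · refine Nat.le_zero.1 ((hF _ _).2 ?_)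
    have : (1 : Lamplighter (ℤ × ZMod 2) L).lit = ∅ := by ext v; simp
    rw [this]
    exact Tour.nil
  · intro g hg
    have H := (hF g 0).1 hg.le
    generalize hp : g.pos = p at H
    generalize hV : g.lit = V at H
    cases H
    ext v
    · rw [hp]; rfl
    · rw [hp]; rfl
    · have : v ∉ g.lit := by simp [hV]
      simpa using this
  · intro g k hg
    have H := (hF g (k + 1)).1 hg.le
    generalize hp : g.pos = q at H
    generalize hW : g.lit = W at H
    cases H with
    | stay H =>
      subst hp hW
      have := (hF g k).2 H
      omega
    | @step _ p _ V _ H hadj hV =>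
      have hadj' : (mulCayley (ladderGenerators L)).Adj g (g.modify p {p, q} fun _ => 1) := by
        rw [ladder_adj_iff]
        refine ⟨by simpa [hp] using hadj.symm, fun v hv hv' => ?_⟩
        rw [hp] at hv
        simp only [modify_pos] at hv'
        simp [modify_lamp, hv, hv']
      refine ⟨_, hadj', ?_⟩
      have h₁ : F (g.modify p {p, q} fun _ => 1) ≤ k := by
        refine (hF _ _).2 (H.mono fun v hv => ?_)
        rw [mem_lit, modify_lamp] at hv
        split_ifs at hv with hv'
        · exact absurd rfl hv
        · have h₁ := hV (hW ▸ mem_lit.2 hv)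
          simp only [Finset.mem_insert, Finset.mem_singleton] at h₁ hv'
          tauto
      have h₂ := h_lip _ _ hadj'.symm
      omega

end Lamplighter

namespace Lamplighter

open SimpleGraph Cayley

variable {L : Type*} [Group L]

/-! ### Filling walks and the retreat depth for switch-walk-switch generators -/

/-- The word length for the switch-walk-switch generators on the ladder. -/
noncomputable abbrev ladderLength (g : Lamplighter (ℤ × ZMod 2) L) : ℕ :=
  wordLength (ladderGenerators L) g

theorem ladder_connected : (mulCayley (ladderGenerators L)).Connected := (ladder_metric L).1

theorem ladderLength_le_iff {g : Lamplighter (ℤ × ZMod 2) L} {k : ℕ} :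
    ladderLength g ≤ k ↔ Tour k g.pos g.lit := (ladder_metric L).2.2 g k

theorem tour_ladderLength (g : Lamplighter (ℤ × ZMod 2) L) :
    Tour (ladderLength g) g.pos g.lit := ladderLength_le_iff.1 le_rfl

theorem ladderLength_mirror (g : Lamplighter (ℤ × ZMod 2) L) :
    ladderLength g.mirror = ladderLength g :=
  wordLength_involution ladder_connected mirror_one ladder_adj_mirror mirror_mirror g

theorem ladderLength_le_of_adj {g h : Lamplighter (ℤ × ZMod 2) L}
    (H : (mulCayley (ladderGenerators L)).Adj g h) : ladderLength h ≤ ladderLength g + 1 :=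
  wordLength_le_succ ladder_connected H

theorem reach_le_ladderLength (g : Lamplighter (ℤ × ZMod 2) L) : g.reach ≤ ladderLength g := by
  have := (tour_ladderLength g).col_le
  exact reach_le_iff.2 ⟨by omega, this.1, fun v hv => this.2 v (mem_lit.2 hv)⟩

/-- Walk right from the current position to the column `c`, leaving every lamp of the columns
passed through in the state `l`. -/
noncomputable def fill (l : L) (g : Lamplighter (ℤ × ZMod 2) L) (c : ℤ) :
    Lamplighter (ℤ × ZMod 2) L :=
  g.modify (c, 0) (columns g.pos.1 c) fun _ => l

/-- Put the lamp at `(j, 0)` in the state `l`, without moving. -/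
noncomputable def light (l : L) (j : ℤ) (g : Lamplighter (ℤ × ZMod 2) L) :
    Lamplighter (ℤ × ZMod 2) L :=
  g.modify g.pos {(j, 0)} fun _ => l

@[simp] theorem fill_pos (l : L) (g : Lamplighter (ℤ × ZMod 2) L) (c : ℤ) :
    (fill l g c).pos = (c, 0) := rfl

theorem fill_lamp (l : L) (g : Lamplighter (ℤ × ZMod 2) L) (c : ℤ) (v) :
    (fill l g c).lamp v = if g.pos.1 ≤ v.1 ∧ v.1 ≤ c then l else g.lamp v := by
  simp [fill, modify_lamp]

@[simp] theorem light_pos (l : L) (j : ℤ) (g : Lamplighter (ℤ × ZMod 2) L) :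
    (light l j g).pos = g.pos := rfl

theorem light_lamp (l : L) (j : ℤ) (g : Lamplighter (ℤ × ZMod 2) L) (v) :
    (light l j g).lamp v = if v = (j, 0) then l else g.lamp v := by
  simp [light, modify_lamp]

theorem card_columns (x c : ℤ) : (columns x c).card = 2 * (c + 1 - x).toNat := by
  simp [columns, mul_comm]

variable {l : L}

/-- Filling cannot shorten an element much: in a tour realizing `fill l g c`, the part to the right
of the initial column is at least about as long as a loop around the ladder. -/
theorem ladderLength_le_fill (hl : l ≠ 1) {g : Lamplighter (ℤ × ZMod 2) L} {c : ℤ}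
    (hx : 0 ≤ g.pos.1) (hc : g.pos.1 ≤ c) : ladderLength g ≤ ladderLength (fill l g c) + 3 := by
  set x := g.pos.1 with hxdef
  obtain ⟨k₁, ε₁, B, h₁, -, h₂, h₃, h₄, -, h₅, -⟩ :=
    (tour_ladderLength (fill l g c)).trunc (hx.trans hc)
  have h₅ := h₅ (by simp)
  set V := (fill l g c).lit with hV
  have hmem : ∀ v : ℤ × ZMod 2, v ∈ V ↔ (x ≤ v.1 ∧ v.1 ≤ c) ∨ g.lamp v ≠ 1 := by
    intro v
    rw [hV, mem_lit, fill_lamp, ← hxdef]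
    split_ifs with h <;> simp [h, hl]
  simp only [fill_pos, min_self] at h₁
  have key : ∃ (k₂ : ℕ) (ε₂ : ZMod 2), Tour k₂ (x, ε₂) (V.filter (·.1 < x)) ∧
      (k₂ : ℤ) + 2 * (c - x) ≤ k₁ := by
    rcases hc.eq_or_lt with heq | hlt
    · refine ⟨k₁, ε₁, ?_, by omega⟩
      rw [heq]
      exact h₁.mono fun v hv => by
        simp only [Finset.mem_filter] at hv ⊢
        exact ⟨hv.1, Or.inl hv.2⟩
    · obtain ⟨k₂, ε₂, -, h₁', -, h₂', -⟩ := h₁.trunc hx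
      simp only [min_eq_right hc] at h₁'
      refine ⟨k₂, ε₂, h₁'.mono fun v hv => ?_, ?_⟩
      · simp only [Finset.mem_filter] at hv ⊢
        exact ⟨⟨hv.1, Or.inl (by omega)⟩, Or.inl hv.2⟩
      · have hsub : columns (x + 1) c ⊆ (insert (c, ε₁) (V.filter fun v =>
            v.1 < c ∨ (v.1 = c ∧ 0 < c))).filter (x < ·.1) := by
          intro v hv
          rw [mem_columns] at hv
          simp only [Finset.mem_filter, Finset.mem_insert, hmem]
          exact ⟨Or.inr ⟨Or.inl ⟨by omega, by omega⟩, by omega⟩, by omega⟩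
        have := Finset.card_le_card hsub
        rw [card_columns] at this
        omega
  obtain ⟨k₂, ε₂, h₆, h₇⟩ := key
  have hloop := (h₆.loop (W := g.lit) (B - x).toNat (fun v hv => by
    rw [mem_lit] at hv
    have hvV := (hmem v).2 (Or.inr hv)
    have := h₃ v hvV
    simp only [Finset.mem_filter]
    by_cases hvx : v.1 < x
    · exact Or.inl ⟨hvV, hvx⟩
    · right; omega)).change_row g.pos.2
  refine ladderLength_le_iff.2 (hloop.le ?_)
  omega

theorem fill_le_ladderLength {g : Lamplighter (ℤ × ZMod 2) L} {c : ℤ}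
    (hx : 0 ≤ g.pos.1) (hc : g.pos.1 ≤ c) (hcr : c ≤ g.reach) :
    ladderLength (fill l g c) ≤ ladderLength g + 4 := by
  set x := g.pos.1 with hxdef
  obtain ⟨k₁, ε₁, B, h₁, -, -, h₃, h₄, -, h₅, -⟩ := (tour_ladderLength g).trunc hx
  have h₅ := h₅ le_rfl
  rw [← hxdef, min_self] at h₁
  have hB : g.reach ≤ B :=
    reach_le_iff.2 ⟨hx.trans h₄, h₄, fun v hv => h₃ v (mem_lit.2 hv)⟩
  obtain ⟨ε₂, h₆⟩ := h₁.zigzag (W := (g.lit.filter (·.1 < x)) ∪ columns x c) (c - x).toNat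
    (fun v hv => by
      simp only [Finset.mem_union, Finset.mem_filter, mem_columns] at hv ⊢
      rcases hv with h | h
      · exact Or.inl ⟨h.1, Or.inl h.2⟩
      · right; omega)
  have hcx : x + ((c - x).toNat : ℤ) = c := by omega
  rw [hcx] at h₆
  have h₇ := (h₆.loop (W := (fill l g c).lit) (B - c).toNat (fun v hv => by
    rw [mem_lit, fill_lamp] at hv
    simp only [Finset.mem_union, Finset.mem_filter, mem_columns]
    by_cases hv' : x ≤ v.1 ∧ v.1 ≤ c
    · exact Or.inl (Or.inr hv')
    · rw [if_neg hv'] at hv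
      have := h₃ v (mem_lit.2 hv)
      by_cases hvx : v.1 < x
      · exact Or.inl (Or.inl ⟨mem_lit.2 hv, hvx⟩)
      · right; omega)).change_row 0
  refine ladderLength_le_iff.2 (h₇.le ?_)
  omega

theorem linked_of_same_column {A : Set (Lamplighter (ℤ × ZMod 2) L)}
    {g h : Lamplighter (ℤ × ZMod 2) L} (hcol : h.pos.1 = g.pos.1)
    (hlamp : ∀ v : ℤ × ZMod 2, v.1 ≠ g.pos.1 → g.lamp v = h.lamp v) (hg : g ∈ A) (hh : h ∈ A)
    (hA : ∀ k, (mulCayley (ladderGenerators L)).Adj g k → k ∈ A) :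
    Linked (ladderGenerators L) A g h := by
  have cover : ∀ ε ε' : ZMod 2, ε ≠ ε' → ∀ v : ℤ × ZMod 2, v ≠ (g.pos.1, ε) →
      v ≠ (g.pos.1, ε') → v.1 ≠ g.pos.1 := by
    intro ε ε' hε v hv hv' h
    have : ∀ ε ε' : ZMod 2, ε ≠ ε' → ε' = ε + 1 := by decide
    rw [this ε ε' hε] at hv'
    rcases Tour.eq_or_eq_of_fst ε h with h | h <;> contradiction
  by_cases hrow : g.pos.2 = h.pos.2
  · have hpos : h.pos = (g.pos.1, g.pos.2) := Prod.ext hcol hrow.symm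
    have h₁ : (mulCayley (ladderGenerators L)).Adj g
        (h.modify (g.pos.1, g.pos.2 + 1) ∅ fun _ => 1) := by
      rw [ladder_adj_iff]
      refine ⟨Tour.vertical_adj _ _, fun v hv hv' => ?_⟩
      simpa [modify_lamp] using hlamp v (cover g.pos.2 (g.pos.2 + 1) (by simp) v hv hv')
    have h₂ : (mulCayley (ladderGenerators L)).Adj
        (h.modify (g.pos.1, g.pos.2 + 1) ∅ fun _ => 1) h := by
      rw [ladder_adj_iff, hpos]
      exact ⟨(Tour.vertical_adj _ _).symm, fun v _ _ => by simp [modify_lamp]⟩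
    exact (Linked.of_adj h₁ hg (hA _ h₁)).trans (Linked.of_adj h₂ (hA _ h₁) hh)
  · refine Linked.of_adj ?_ hg hh
    rw [ladder_adj_iff]
    refine ⟨Or.inl ⟨hcol.symm, hrow⟩, fun v hv hv' => hlamp v ?_⟩
    exact cover _ _ hrow v hv (by rwa [← hcol])

/-- If the vertices `fill l g c` and their neighbours belong to `A`, the walk to the right which
fills the ladder stays in `A`. -/
theorem linked_fill {A : Set (Lamplighter (ℤ × ZMod 2) L)} {g : Lamplighter (ℤ × ZMod 2) L}
    (hg : g ∈ A) (hgA : ∀ k, (mulCayley (ladderGenerators L)).Adj g k → k ∈ A) (t : ℕ)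
    (hA : ∀ s ≤ t, fill l g (g.pos.1 + s) ∈ A ∧
      ∀ k, (mulCayley (ladderGenerators L)).Adj (fill l g (g.pos.1 + s)) k → k ∈ A) :
    Linked (ladderGenerators L) A g (fill l g (g.pos.1 + t)) := by
  induction t with
  | zero =>
    refine linked_of_same_column (by simp) (fun v hv => ?_) hg (hA 0 le_rfl).1 hgA
    rw [fill_lamp, if_neg]
    push_cast
    omega
  | succ t ih =>
    refine (ih fun s hs => hA s (hs.trans (Nat.le_succ t))).trans ?_
    have hA₁ := hA t (Nat.le_succ t)
    have hA₂ := hA (t + 1) le_rfl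
    set c := g.pos.1 + (t : ℤ) with hc
    have hc' : g.pos.1 + ((t + 1 : ℕ) : ℤ) = c + 1 := by push_cast; omega
    rw [hc'] at hA₂ ⊢
    have h₁ : (mulCayley (ladderGenerators L)).Adj (fill l g c)
        ((fill l g c).modify (c + 1, 0) ∅ fun _ => 1) := by
      rw [ladder_adj_iff]
      exact ⟨Tour.right_adj c 0, fun v _ _ => by simp [modify_lamp]⟩
    have hm := hA₁.2 _ h₁
    refine (Linked.of_adj h₁ hA₁.1 hm).trans (Linked.symm ?_)
    refine linked_of_same_column rfl (fun v hv => ?_) hA₂.1 hm hA₂.2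
    simp only [fill_pos] at hv
    simp only [modify_lamp, fill_lamp, Finset.notMem_empty, if_false]
    congr 1
    simp only [eq_iff_iff]
    omega

theorem mem_infinitePart_ladder [Nontrivial L] (g : Lamplighter (ℤ × ZMod 2) L) :
    g ∈ infinitePart (ladderGenerators L) (ladderLength g - 5) := by
  obtain ⟨l, hl⟩ := exists_ne (1 : L)
  have key : ∀ g : Lamplighter (ℤ × ZMod 2) L, 0 ≤ g.pos.1 →
      g ∈ infinitePart (ladderGenerators L) (ladderLength g - 5) := by
    intro g hx
    have hout : ∀ a b : Lamplighter (ℤ × ZMod 2) L, ladderLength g ≤ ladderLength a + 3 →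
        (mulCayley (ladderGenerators L)).Adj a b →
        b ∈ outerSet (ladderGenerators L) (ladderLength g - 5) := by
      intro a b ha hab
      have := ladderLength_le_of_adj hab.symm
      change ladderLength g - 5 ≤ ladderLength b
      omega
    have hlink : ∀ t : ℕ, fill l g (g.pos.1 + t) ∈
        outerComponent (ladderGenerators L) (ladderLength g - 5) g := by
      intro t
      rw [mem_outerComponent_iff]
      have hg : g ∈ outerSet (ladderGenerators L) (ladderLength g - 5) := Nat.sub_le _ _
      refine ⟨hg, linked_fill hg (fun k hk => hout g k (by omega) hk) t fun s _ => ?_⟩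
      have := ladderLength_le_fill hl hx (c := g.pos.1 + s) (by omega)
      refine ⟨?_, fun k hk => hout _ k this hk⟩
      change ladderLength g - 5 ≤ ladderLength _
      omega
    refine Set.infinite_of_injective_forall_mem (f := fun t : ℕ => fill l g (g.pos.1 + t)) ?_ hlink
    intro s t hst
    have := congrArg (fun h => h.pos.1) hst
    simpa using this
  rcases le_total 0 g.pos.1 with h | h
  · exact key g h
  · have := infinitePart_involution ladder_adj_mirror mirror_mirror ladderLength_mirror
      (key g.mirror (by simpa using h))
    rwa [mirror_mirror, ladderLength_mirror] at this

end Lamplighter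

namespace Lamplighter

open SimpleGraph Cayley

variable {L : Type*} [Group L] {l : L}

/-! ### The connection thickness for switch-walk-switch generators -/

theorem mem_ladder_annulus {g : Lamplighter (ℤ × ZMod 2) L} {lo hi : ℕ}
    (h₁ : lo ≤ ladderLength g) (h₂ : ladderLength g ≤ hi) :
    g ∈ annulus (ladderGenerators L) lo hi :=
  ⟨h₁, h₂⟩

theorem ladderLength_mono {g h : Lamplighter (ℤ × ZMod 2) L} (hpos : g.pos = h.pos)
    (hlit : g.lit ⊆ h.lit) : ladderLength g ≤ ladderLength h := by
  rw [ladderLength_le_iff, hpos]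
  exact (tour_ladderLength h).mono hlit

/-- Elements which differ only by lamps located between the position and a column `c` within reach,
and by the lamp at `(c + 1, 0)`, are linked by walks to the right which fill the ladder up to `c`:
these walks change the length by a bounded amount only. -/
theorem linked_of_agree (hl : l ≠ 1) {n : ℕ} {g h : Lamplighter (ℤ × ZMod 2) L} {c : ℤ}
    (hpos : h.pos = g.pos) (hx : 0 ≤ g.pos.1) (hc : g.pos.1 ≤ c) (hg : c ≤ g.reach)
    (hh : c ≤ h.reach)
    (hlamp : ∀ v, ¬ (g.pos.1 ≤ v.1 ∧ v.1 ≤ c) → v ≠ (c + 1, 0) → g.lamp v = h.lamp v)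
    (hg₁ : n + 4 ≤ ladderLength g) (hg₂ : ladderLength g ≤ n + 19)
    (hh₁ : n + 4 ≤ ladderLength h) (hh₂ : ladderLength h ≤ n + 19) :
    Linked (ladderGenerators L) (annulus (ladderGenerators L) n (n + 24)) g h := by
  have hnear : ∀ {a b : Lamplighter (ℤ × ZMod 2) L}, n + 1 ≤ ladderLength a →
      ladderLength a ≤ n + 23 → (mulCayley (ladderGenerators L)).Adj a b →
      b ∈ annulus (ladderGenerators L) n (n + 24) := by
    intro a b h₁ h₂ hab
    have h₃ := ladderLength_le_of_adj hab
    have h₄ := ladderLength_le_of_adj hab.symm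
    exact mem_ladder_annulus (by omega) (by omega)
  have walk : ∀ a : Lamplighter (ℤ × ZMod 2) L, a.pos = g.pos → c ≤ a.reach →
      n + 4 ≤ ladderLength a → ladderLength a ≤ n + 19 →
      Linked (ladderGenerators L) (annulus (ladderGenerators L) n (n + 24)) a (fill l a c) := by
    intro a hpa hca h₁ h₂
    have hac : a.pos.1 ≤ c := by rwa [hpa]
    have := linked_fill (l := l) (A := annulus (ladderGenerators L) n (n + 24)) (g := a)
      (mem_ladder_annulus (by omega) (by omega)) (fun k hk => hnear (by omega) (by omega) hk)
      (c - a.pos.1).toNat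
      fun s hs => by
        have h₃ := ladderLength_le_fill hl (g := a) (c := a.pos.1 + s) (by rwa [hpa]) (by omega)
        have h₄ := fill_le_ladderLength (l := l) (g := a) (c := a.pos.1 + s) (by rwa [hpa])
          (by omega) (by omega)
        exact ⟨mem_ladder_annulus (by omega) (by omega), fun k hk => hnear (by omega) (by omega) hk⟩
    rwa [show a.pos.1 + ((c - a.pos.1).toNat : ℤ) = c by rw [hpa]; omega] at this
  refine (walk g rfl hg hg₁ hg₂).trans (Linked.trans ?_ (walk h hpos hh hh₁ hh₂).symm)
  have e₁ := ladderLength_le_fill hl (g := g) hx hc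
  have e₂ := fill_le_ladderLength (l := l) (g := g) hx hc hg
  have e₃ := ladderLength_le_fill hl (g := h) (c := c) (by rwa [hpos]) (by rwa [hpos])
  have e₄ := fill_le_ladderLength (l := l) (g := h) (by rwa [hpos]) (by rwa [hpos]) hh
  have h₁ : (mulCayley (ladderGenerators L)).Adj (fill l g c)
      ((fill l h c).modify (c + 1, 0) ∅ fun _ => 1) := by
    rw [ladder_adj_iff]
    refine ⟨Tour.right_adj c 0, fun v _ hv' => ?_⟩
    simp only [modify_lamp, fill_lamp, Finset.notMem_empty, if_false, hpos]
    split_ifs with hv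
    · rfl
    · exact hlamp v hv (by simpa using hv')
  have h₂ : (mulCayley (ladderGenerators L)).Adj
      ((fill l h c).modify (c + 1, 0) ∅ fun _ => 1) (fill l h c) := by
    rw [ladder_adj_iff]
    exact ⟨(Tour.right_adj c 0).symm, fun v _ _ => by simp [modify_lamp]⟩
  have hm := hnear (by omega) (by omega) h₁
  exact (Linked.of_adj h₁ (mem_ladder_annulus (by omega) (by omega)) hm).trans
    (Linked.of_adj h₂ hm (mem_ladder_annulus (by omega) (by omega)))

theorem lit_subset_light (hl : l ≠ 1) (j : ℤ) (g : Lamplighter (ℤ × ZMod 2) L) :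
    g.lit ⊆ (light l j g).lit := by
  intro v hv
  rw [mem_lit] at hv ⊢
  rw [light_lamp]
  split_ifs
  exacts [hl, hv]

theorem ladderLength_le_light (hl : l ≠ 1) (j : ℤ) (g : Lamplighter (ℤ × ZMod 2) L) :
    ladderLength g ≤ ladderLength (light l j g) :=
  ladderLength_mono rfl (lit_subset_light hl j g)

theorem le_reach_light (hl : l ≠ 1) (j : ℤ) (g : Lamplighter (ℤ × ZMod 2) L) :
    j ≤ (light l j g).reach :=
  le_reach (v := (j, 0)) (by simpa [light_lamp] using hl)

/-- Retracting the ladder onto the columns up to `j ≥ 1` maps tours to tours. -/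
theorem Tour.retract {k : ℕ} {p : ℤ × ZMod 2} {V : Finset (ℤ × ZMod 2)} (H : Tour k p V) {j : ℤ}
    (hj : 1 ≤ j) : Tour k (min p.1 j, p.2) (V.image fun v => (min v.1 j, v.2)) := by
  induction H with
  | nil =>
    have : (min (0 : ℤ × ZMod 2).1 j, (0 : ℤ × ZMod 2).2) = 0 := by
      ext
      · simp; omega
      · simp
    rw [this, Finset.image_empty]
    exact Tour.nil
  | stay _ ih => exact ih.stay
  | @step k p q V V' _ hadj hV ih =>
    have hsub := Finset.image_subset_image (f := fun v : ℤ × ZMod 2 => (min v.1 j, v.2)) hV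
    rw [Finset.image_insert, Finset.image_insert] at hsub
    by_cases heq : (min p.1 j, p.2) = (min q.1 j, q.2)
    · have hne : (min q.1 j, q.2) ≠ (0 : ℤ × ZMod 2) := by
        intro h
        have h₁ := congrArg Prod.fst h
        have h₂ := congrArg Prod.fst heq
        have h₃ := congrArg Prod.snd heq
        simp only [Prod.fst_zero] at h₁ h₂ h₃
        rcases hadj with ⟨-, h⟩ | ⟨h, -⟩
        · exact h h₃
        · omega
      rw [heq, Finset.insert_idem] at hsub
      rw [heq] at ih
      exact ((ih.insert_end hne).mono hsub).stay
    · refine ih.step ?_ hsub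
      rcases hadj with ⟨h₁, h₂⟩ | ⟨h₁, h₂⟩
      · exact Or.inl ⟨by simp [h₁], h₂⟩
      · refine Or.inr ⟨?_, h₂⟩
        have : min p.1 j ≠ min q.1 j := fun h => heq (by rw [h, h₂])
        simp only
        omega

theorem ladderLength_light_le_succ (hl : l ≠ 1) {g : Lamplighter (ℤ × ZMod 2) L} {j : ℤ}
    (hj : g.reach < j) : ladderLength (light l j g) ≤ ladderLength (light l (j + 1) g) := by
  have h0 := g.reach_nonneg
  have hp := g.pos_le_reach
  have H := (tour_ladderLength (light l (j + 1) g)).retract (j := j) (by omega)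
  rw [light_pos, min_eq_left (by omega)] at H
  refine ladderLength_le_iff.2 (H.mono fun v hv => ?_)
  rw [mem_lit, light_lamp] at hv
  rw [Finset.mem_image]
  by_cases hv' : v = (j, 0)
  · exact ⟨(j + 1, 0), by simpa [light_lamp] using hl, by simp [hv']⟩
  · rw [if_neg hv'] at hv
    refine ⟨v, lit_subset_light hl _ _ (mem_lit.2 hv), ?_⟩
    have := le_reach hv
    rw [min_eq_left (by omega)]

theorem ladderLength_light_le {g : Lamplighter (ℤ × ZMod 2) L} (hl : l ≠ 1) {j j' : ℤ}
    (hj : g.reach < j) (hjj' : j ≤ j') :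
    ladderLength (light l j g) ≤ ladderLength (light l j' g) := by
  obtain ⟨m, rfl⟩ := Int.le.dest hjj'
  clear hjj'
  induction m with
  | zero => simp
  | succ m ih =>
    refine ih.trans ?_
    push_cast
    rw [← add_assoc]
    exact ladderLength_light_le_succ hl (by omega)

theorem ladderLength_light_succ_le (hl : l ≠ 1) (g : Lamplighter (ℤ × ZMod 2) L) (j : ℤ) :
    ladderLength (light l (j + 1) g) ≤ ladderLength (light l j g) + 2 := by
  have H := (tour_ladderLength (light l j g)).detour (v := (j, 0)) (w := (j + 1, 0))
    (Or.inr (Or.inr (by simpa [light_lamp] using hl))) (Or.inr (Tour.right_adj j 0))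
  refine ladderLength_le_iff.2 (H.mono fun v hv => ?_)
  rw [mem_lit, light_lamp] at hv
  rw [Finset.mem_insert]
  by_cases hv' : v = (j + 1, 0)
  · exact Or.inl hv'
  · rw [if_neg hv'] at hv
    exact Or.inr (lit_subset_light hl _ _ (mem_lit.2 hv))

theorem ladderLength_light_reach_le (g : Lamplighter (ℤ × ZMod 2) L) :
    ladderLength (light l (g.reach + 1) g) ≤ ladderLength g + 4 := by
  have H : ∃ ε : ZMod 2, ((g.reach, ε) : ℤ × ZMod 2) = 0 ∨ (g.reach, ε) = g.pos ∨
      (g.reach, ε) ∈ g.lit := by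
    rcases g.reach_attained with h | h | ⟨v, hv, h⟩
    · exact ⟨0, Or.inl (by rw [h]; rfl)⟩
    · exact ⟨g.pos.2, Or.inr (Or.inl (by rw [h]))⟩
    · refine ⟨v.2, Or.inr (Or.inr ?_)⟩
      rw [← h]
      exact mem_lit.2 hv
  obtain ⟨ε, hε⟩ := H
  have h₁ := (tour_ladderLength g).detour hε (w := (g.reach, 0)) (by
    rcases zmod_two_cases ε with rfl | rfl
    · exact Or.inl rfl
    · exact Or.inr (Or.inl ⟨rfl, by simp⟩))
  have h₂ := h₁.detour (v := (g.reach, 0)) (w := (g.reach + 1, 0)) (by simp)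
    (Or.inr (Tour.right_adj _ _))
  refine ladderLength_le_iff.2 (h₂.mono fun v hv => ?_)
  rw [mem_lit, light_lamp] at hv
  simp only [Finset.mem_insert]
  by_cases hv' : v = (g.reach + 1, 0)
  · exact Or.inl hv'
  · rw [if_neg hv'] at hv
    exact Or.inr (Or.inr (mem_lit.2 hv))

theorem linked_light {n : ℕ} {g : Lamplighter (ℤ × ZMod 2) L} (hl : l ≠ 1)
    (hx : 0 ≤ g.pos.1) {j j' : ℤ} (hj : g.reach < j) (hjj' : j ≤ j')
    (h₁ : n + 4 ≤ ladderLength (light l j g)) (h₂ : ladderLength (light l j' g) ≤ n + 19) :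
    Linked (ladderGenerators L) (annulus (ladderGenerators L) n (n + 24))
      (light l j g) (light l j' g) := by
  obtain ⟨m, rfl⟩ := Int.le.dest hjj'
  clear hjj'
  induction m with
  | zero => simpa using Linked.refl _
  | succ m ih =>
    push_cast at h₂ ⊢
    rw [← add_assoc] at h₂ ⊢
    have e₁ := ladderLength_light_le hl hj (j' := j + m) (by omega)
    have e₂ := ladderLength_light_le_succ hl (g := g) (j := j + m) (by omega)
    refine (ih (by omega)).trans ?_
    have := g.pos_le_reach
    refine linked_of_agree hl (c := j + m) rfl hx (by simp only [light_pos]; omega)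
      (le_reach_light hl _ _) ((by omega : j + (m : ℤ) ≤ j + m + 1).trans (le_reach_light hl _ _))
      (fun v hv hv' => ?_) (by omega) (by omega) (by omega) h₂
    simp only [light_pos] at hv
    rw [light_lamp, light_lamp, if_neg hv', if_neg]
    rintro rfl
    exact hv ⟨by simp only; omega, le_rfl⟩

theorem linked_light_reach {n : ℕ} {g : Lamplighter (ℤ × ZMod 2) L} (hl : l ≠ 1)
    (hx : 0 ≤ g.pos.1) (h₁ : n + 4 ≤ ladderLength g)
    (h₂ : ladderLength (light l (g.reach + 1) g) ≤ n + 19) :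
    Linked (ladderGenerators L) (annulus (ladderGenerators L) n (n + 24))
      g (light l (g.reach + 1) g) := by
  have e := ladderLength_le_light hl (g.reach + 1) g
  refine linked_of_agree hl (c := g.reach) rfl hx g.pos_le_reach le_rfl
    ((by omega : g.reach ≤ g.reach + 1).trans (le_reach_light hl _ _))
    (fun v _ hv' => ?_) h₁ (by omega) (by omega) h₂
  rw [light_lamp, if_neg hv']

/-- `Extends l M g h`: the element `h` is obtained from `g` by lighting one lamp to the right of
everything, at such a distance that the length of `h` is about `M`. -/
def Extends (l : L) (M : ℕ) (g h : Lamplighter (ℤ × ZMod 2) L) : Prop :=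
  ∃ j, g.reach < j ∧ h = light l j g ∧ M ≤ ladderLength h ∧ ladderLength h ≤ M + 4

theorem exists_extends (hl : l ≠ 1) {M : ℕ} {g : Lamplighter (ℤ × ZMod 2) L}
    (hg : ladderLength g ≤ M) : ∃ h, Extends l M g h := by
  classical
  have hex : ∃ m : ℕ, M ≤ ladderLength (light l (g.reach + 1 + m) g) := by
    refine ⟨M, ?_⟩
    have h₁ := le_reach_light hl (g.reach + 1 + M) g
    have h₂ := reach_le_ladderLength (light l (g.reach + 1 + M) g)
    have h₃ := g.reach_nonneg
    omega
  refine ⟨_, g.reach + 1 + (Nat.find hex : ℕ), by omega, rfl, Nat.find_spec hex, ?_⟩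
  rcases h : Nat.find hex with _ | m
  · have := ladderLength_light_reach_le (l := l) g
    simp only [Nat.cast_zero, add_zero]
    omega
  · have h₁ := Nat.find_min hex (m := m) (by omega)
    have h₂ := ladderLength_light_succ_le hl g (g.reach + 1 + m)
    push_cast
    rw [← add_assoc]
    omega

theorem linked_extends {n M : ℕ} {g h : Lamplighter (ℤ × ZMod 2) L} (hl : l ≠ 1)
    (hx : 0 ≤ g.pos.1) (hg : n + 4 ≤ ladderLength g) (hM : M ≤ n + 15) (hgh : Extends l M g h) :
    Linked (ladderGenerators L) (annulus (ladderGenerators L) n (n + 24)) g h := by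
  obtain ⟨j, hj, rfl, h₁, h₂⟩ := hgh
  have e₁ := ladderLength_le_light hl (g.reach + 1) g
  have e₂ := ladderLength_light_le hl (g := g) (j := g.reach + 1) (j' := j) (by omega) (by omega)
  exact (linked_light_reach hl hx hg (by omega)).trans
    (linked_light hl hx (by omega) (by omega) (by omega) (by omega))

/-- If lighting a far lamp turns `g` and `g'` into linked elements of nearly the same length,
the extensions of `g` and `g'` of length about `M` are linked. -/
theorem linked_of_extends {n M : ℕ} {g g' h h' : Lamplighter (ℤ × ZMod 2) L} (hl : l ≠ 1)
    (hx : 0 ≤ g.pos.1) (hx' : 0 ≤ g'.pos.1) (hM₁ : n + 4 ≤ M) (hM₂ : M ≤ n + 11)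
    (hgg' : ∀ j, g.reach < j → g'.reach < j →
      ladderLength (light l j g) ≤ ladderLength (light l j g') + 4 ∧
      ladderLength (light l j g') ≤ ladderLength (light l j g) + 4 ∧
      (M ≤ ladderLength (light l j g) → M ≤ ladderLength (light l j g') →
        ladderLength (light l j g) ≤ M + 8 → ladderLength (light l j g') ≤ M + 8 →
        Linked (ladderGenerators L) (annulus (ladderGenerators L) n (n + 24))
          (light l j g) (light l j g')))
    (hgh : Extends l M g h) (hgh' : Extends l M g' h') :
    Linked (ladderGenerators L) (annulus (ladderGenerators L) n (n + 24)) h h' := by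
  obtain ⟨j, hj, rfl, h₁, h₂⟩ := hgh
  obtain ⟨j', hj', rfl, h₁', h₂'⟩ := hgh'
  rcases le_total j j' with hjj' | hjj'
  · have H := hgg' j' (by omega) hj'
    have e := ladderLength_light_le hl hj hjj'
    exact (linked_light hl hx hj hjj' (by omega) (by omega)).trans
      (H.2.2 (by omega) h₁' (by omega) (by omega))
  · have H := hgg' j hj (by omega)
    have e := ladderLength_light_le hl hj' hjj'
    exact (H.2.2 h₁ (by omega) (by omega) (by omega)).trans
      (linked_light hl hx' hj' hjj' (by omega) (by omega)).symm

theorem linked_extends_of_adj {n M : ℕ} {g g' h h' : Lamplighter (ℤ × ZMod 2) L} (hl : l ≠ 1)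
    (hx : 0 ≤ g.pos.1) (hx' : 0 ≤ g'.pos.1) (hM₁ : n + 4 ≤ M) (hM₂ : M ≤ n + 11)
    (hadj : (mulCayley (ladderGenerators L)).Adj g g')
    (hgh : Extends l M g h) (hgh' : Extends l M g' h') :
    Linked (ladderGenerators L) (annulus (ladderGenerators L) n (n + 24)) h h' := by
  refine linked_of_extends hl hx hx' hM₁ hM₂ (fun j _ _ => ?_) hgh hgh'
  have H : (mulCayley (ladderGenerators L)).Adj (light l j g) (light l j g') := by
    rw [ladder_adj_iff] at hadj ⊢
    refine ⟨hadj.1, fun v hv hv' => ?_⟩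
    rw [light_lamp, light_lamp, hadj.2 v hv hv']
  have e₁ := ladderLength_le_of_adj H
  have e₂ := ladderLength_le_of_adj H.symm
  exact ⟨by omega, by omega, fun _ _ _ _ =>
    Linked.of_adj H (mem_ladder_annulus (by omega) (by omega))
      (mem_ladder_annulus (by omega) (by omega))⟩

theorem linked_mirror_ladder {n m : ℕ} {g h : Lamplighter (ℤ × ZMod 2) L}
    (H : Linked (ladderGenerators L) (annulus (ladderGenerators L) n m) g h) :
    Linked (ladderGenerators L) (annulus (ladderGenerators L) n m) g.mirror h.mirror := by
  refine H.map ladder_adj_mirror fun a ha => ?_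
  have := ladderLength_mirror a
  exact mem_ladder_annulus (this.symm ▸ ha.1) (this.symm ▸ ha.2)

theorem mirror_light_comm {i j : ℤ} (hij : -i ≠ j) (g : Lamplighter (ℤ × ZMod 2) L) :
    light l j (light l i g.mirror).mirror = (light l i (light l j g).mirror).mirror := by
  ext v
  · simp
  · simp
  · simp only [light_lamp, mirror_lamp, flip_flip]
    by_cases h₁ : v = (j, 0)
    · subst h₁
      have : flip (j, 0) ≠ (i, 0) := fun h => by
        have := congrArg Prod.fst h
        simp only [flip_fst] at this
        omega
      simp [this]
    · rw [if_neg h₁, if_neg h₁]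

theorem reach_mirror_light (hl : l ≠ 1) {j : ℤ} (hj : 0 ≤ j) (g : Lamplighter (ℤ × ZMod 2) L) :
    (light l j g).mirror.reach = g.mirror.reach := by
  refine le_antisymm ?_ ?_
  · refine reach_le_iff.2 ⟨reach_nonneg _, ?_, fun v hv => ?_⟩
    · exact pos_le_reach g.mirror
    · rw [mirror_lamp, light_lamp] at hv
      split_ifs at hv with h
      · have := congrArg Prod.fst h
        have := g.mirror.reach_nonneg
        simp only [flip_fst] at *
        omega
      · exact le_reach (g := g.mirror) hv
  · refine reach_le_iff.2 ⟨reach_nonneg _, ?_, fun v hv => ?_⟩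
    · exact pos_le_reach (light l j g).mirror
    · refine le_reach (g := (light l j g).mirror) ?_
      rw [mirror_lamp] at hv ⊢
      exact mem_lit.1 (lit_subset_light hl j g (mem_lit.2 hv))

/-- At the column of the origin, an extension to the left can be traded for an extension to the
right: the far lamp on the left is brought closer step by step, each step being compensated by
moving the far lamp on the right. -/
theorem linked_extends_mirror {n : ℕ} {g h h' : Lamplighter (ℤ × ZMod 2) L} (hl : l ≠ 1)
    (hx : g.pos.1 = 0)
    (hgh : Extends l (n + 4) g.mirror h.mirror) (hgh' : Extends l (n + 8) g h') :
    Linked (ladderGenerators L) (annulus (ladderGenerators L) n (n + 24)) h h' := by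
  -- `w i` carries a far lamp on the left, at the column `-i`
  set w : ℤ → Lamplighter (ℤ × ZMod 2) L := fun i => (light l i g.mirror).mirror with hw
  have hwx : ∀ i, (w i).pos.1 = 0 := fun i => by simp [hw, hx]
  have hcomm : ∀ i j, 0 < i → 0 < j → light l j (w i) = (light l i (light l j g).mirror).mirror :=
    fun i j hi hj => mirror_light_comm (by omega) g
  have hwlen : ∀ i, ladderLength (w i) = ladderLength (light l i g.mirror) :=
    fun i => ladderLength_mirror _
  obtain ⟨i, hi, hhi, h₁, h₂⟩ := hgh
  have hh : h = w i := by rw [← mirror_mirror h, hhi]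
  subst hh
  rw [ladderLength_mirror] at h₁ h₂
  obtain ⟨e, he⟩ := exists_extends hl (M := n + 8) (g := w i) (by omega)
  refine (linked_extends hl (by rw [hwx]) h₁ (by omega) he).trans ?_
  have ha := g.mirror.reach_nonneg
  clear hhi h₁
  obtain ⟨m, hm⟩ := Int.le.dest (Int.add_one_le_of_lt hi)
  subst hm
  induction m generalizing e with
  | zero =>
    refine linked_of_extends hl (by rw [hwx]) hx.ge (by omega) (by omega) (fun j _ hj => ?_) he hgh'
    have hj0 : 0 < j := by have := g.reach_nonneg; omega
    have hr := reach_mirror_light hl hj0.le g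
    rw [hcomm _ _ (by omega) hj0, ladderLength_mirror, ← ladderLength_mirror (light l j g), ← hr]
    simp only [Nat.cast_zero, add_zero]
    have e₁ := ladderLength_light_reach_le (l := l) (light l j g).mirror
    have e₂ := ladderLength_le_light hl ((light l j g).mirror.reach + 1) (light l j g).mirror
    refine ⟨e₁, by omega, fun _ _ _ _ => ?_⟩
    have := linked_mirror_ladder (linked_light_reach hl (g := (light l j g).mirror) (n := n)
      (by simp [hx]) (by omega) (by omega))
    rw [mirror_mirror] at this
    exact this.symm
  | succ m ih =>
    have e₀ := ladderLength_light_le_succ hl (g := g.mirror) (j := g.mirror.reach + 1 + m)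
      (by omega)
    have hcast : g.mirror.reach + 1 + ((m + 1 : ℕ) : ℤ) = g.mirror.reach + 1 + m + 1 := by
      push_cast; ring
    rw [hcast] at h₂ he
    have hlen : ladderLength (w (g.mirror.reach + 1 + m)) ≤ n + 8 := by
      rw [hwlen] at h₂ ⊢
      omega
    obtain ⟨e', he'⟩ := exists_extends hl (M := n + 8) hlen
    refine Linked.trans ?_ (ih e' (by omega) (by rw [hwlen] at h₂ ⊢; omega) he')
    refine linked_of_extends hl (by rw [hwx]) (by rw [hwx]) (by omega) (by omega)
      (fun j hj _ => ?_) he he'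
    have hj0 : 0 < j := by have := (w (g.mirror.reach + 1 + m + 1)).reach_nonneg; omega
    have hr := reach_mirror_light hl hj0.le g
    rw [hcomm _ _ (by omega) hj0, hcomm _ _ (by omega) hj0, ladderLength_mirror,
      ladderLength_mirror, ← hr]
    have e₁ := ladderLength_light_le_succ hl (g := (light l j g).mirror)
      (j := (light l j g).mirror.reach + 1 + m) (by omega)
    have e₂ := ladderLength_light_succ_le hl (light l j g).mirror
      ((light l j g).mirror.reach + 1 + m)
    refine ⟨by omega, by omega, fun _ _ _ _ => ?_⟩
    exact (linked_mirror_ladder (linked_light hl (n := n) (by simp [hx]) (by omega) (by omega)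
      (by omega) (by omega))).symm

/-- All the extensions of short elements, to the right or to the left, are linked to those of the
identity. -/
theorem linked_extends_one {n : ℕ} {z : Lamplighter (ℤ × ZMod 2) L} (hl : l ≠ 1)
    (hz : Extends l (n + 8) 1 z) (k : ℕ) (hk : k ≤ n + 4) (g : Lamplighter (ℤ × ZMod 2) L)
    (hg : ladderLength g = k) :
    (0 ≤ g.pos.1 → ∀ h, Extends l (n + 8) g h →
      Linked (ladderGenerators L) (annulus (ladderGenerators L) n (n + 24)) h z) ∧
    (g.pos.1 ≤ 0 → ∀ h, Extends l (n + 4) g.mirror h.mirror →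
      Linked (ladderGenerators L) (annulus (ladderGenerators L) n (n + 24)) h z) := by
  have left_of_right : ∀ g : Lamplighter (ℤ × ZMod 2) L, ladderLength g ≤ n + 4 → g.pos.1 = 0 →
      (∀ h, Extends l (n + 8) g h →
        Linked (ladderGenerators L) (annulus (ladderGenerators L) n (n + 24)) h z) →
      ∀ h, Extends l (n + 4) g.mirror h.mirror →
        Linked (ladderGenerators L) (annulus (ladderGenerators L) n (n + 24)) h z := by
    intro g hg hx H h hh
    obtain ⟨e, he⟩ := exists_extends hl (M := n + 8) (g := g) (by omega)
    exact (linked_extends_mirror hl hx hh he).trans (H e he)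
  have right_of_left : ∀ g : Lamplighter (ℤ × ZMod 2) L, ladderLength g ≤ n + 4 → g.pos.1 = 0 →
      (∀ h, Extends l (n + 4) g.mirror h.mirror →
        Linked (ladderGenerators L) (annulus (ladderGenerators L) n (n + 24)) h z) →
      ∀ h, Extends l (n + 8) g h →
        Linked (ladderGenerators L) (annulus (ladderGenerators L) n (n + 24)) h z := by
    intro g hg hx H h hh
    obtain ⟨e, he⟩ := exists_extends hl (M := n + 4) (g := g.mirror)
      (by rw [ladderLength_mirror]; exact hg)
    rw [← mirror_mirror e] at he
    exact (linked_extends_mirror hl hx he hh).symm.trans (H _ he)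
  induction k generalizing g with
  | zero =>
    obtain rfl := eq_one_of_wordLength_eq_zero ladder_connected hg
    have H : ∀ h, Extends l (n + 8) 1 h →
        Linked (ladderGenerators L) (annulus (ladderGenerators L) n (n + 24)) h z := fun h hh =>
      linked_of_extends hl (by simp) (by simp) (by omega) (by omega)
        (fun j _ _ => ⟨by omega, by omega, fun _ _ _ _ => Linked.refl _⟩) hh hz
    exact ⟨fun _ => H, fun _ => left_of_right 1 (by omega) (by simp) H⟩
  | succ k ih =>
    obtain ⟨g', hadj, hg'⟩ := exists_adj_wordLength ladder_connected hg
    have IH := ih (by omega) g' hg'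
    have hcol : g'.pos.1 ≤ g.pos.1 + 1 ∧ g.pos.1 ≤ g'.pos.1 + 1 := by
      rcases (ladder_adj_iff.1 hadj).1 with ⟨h, -⟩ | ⟨h, -⟩ <;> omega
    by_cases hx : 0 ≤ g.pos.1 ∧ 0 ≤ g'.pos.1
    · have H : ∀ h, Extends l (n + 8) g h →
          Linked (ladderGenerators L) (annulus (ladderGenerators L) n (n + 24)) h z := by
        intro h hh
        obtain ⟨h', hh'⟩ := exists_extends hl (M := n + 8) (g := g') (by
          change wordLength _ g' ≤ _
          omega)
        exact (linked_extends_of_adj hl hx.1 hx.2 (by omega) (by omega) hadj hh hh').trans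
          (IH.1 hx.2 h' hh')
      exact ⟨fun _ => H, fun h0 => left_of_right g (by omega) (by omega) H⟩
    · have hx₁ : g.pos.1 ≤ 0 := by omega
      have hx₂ : g'.pos.1 ≤ 0 := by omega
      have H : ∀ h, Extends l (n + 4) g.mirror h.mirror →
          Linked (ladderGenerators L) (annulus (ladderGenerators L) n (n + 24)) h z := by
        intro h hh
        obtain ⟨h', hh'⟩ := exists_extends hl (M := n + 4) (g := g'.mirror) (by
          rw [ladderLength_mirror]
          change wordLength _ g' ≤ _
          omega)
        have := linked_mirror_ladder (linked_extends_of_adj hl (n := n) (by simpa using hx₁)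
          (by simpa using hx₂) (by omega) (by omega) (ladder_adj_mirror _ _ hadj) hh hh')
        rw [mirror_mirror] at this
        refine this.trans (IH.2 hx₂ _ ?_)
        rwa [mirror_mirror]
      exact ⟨fun h0 => right_of_left g (by omega) (by omega) H, fun _ => H⟩

theorem connectionThickness_ladder_le [Finite L] [Nontrivial L] (n : ℕ) :
    connectionThickness (ladderGenerators L) n ≤ 24 := by
  obtain ⟨l, hl⟩ := exists_ne (1 : L)
  obtain ⟨z, hz⟩ := exists_extends hl (M := n + 8) (g := (1 : Lamplighter (ℤ × ZMod 2) L))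
    (by simp)
  refine connectionThickness_le (r := 24) (annulusInf_connected (z := z) ?_ fun g hg => ?_)
  · obtain ⟨-, -, -, h₁, h₂⟩ := hz
    refine ⟨?_, infinitePart_anti ?_ (mem_infinitePart_ladder z)⟩
    · change ladderLength z ≤ _
      omega
    · omega
  · obtain ⟨h, hh, hgh⟩ := exists_linked_wordLength_eq ladder_connected finite_ladderGenerators
      (k := 4) (by norm_num) hg
    refine hgh.trans ?_
    have H := linked_extends_one hl hz (n + 4) le_rfl h hh
    have hh : ladderLength h = n + 4 := hh
    rcases le_total 0 h.pos.1 with hx | hx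
    · obtain ⟨e, he⟩ := exists_extends hl (M := n + 8) (g := h) (by omega)
      exact (linked_extends hl hx (by omega) (by omega) he).trans (H.1 hx e he)
    · obtain ⟨e, he⟩ := exists_extends hl (M := n + 4) (g := h.mirror)
        (by rw [ladderLength_mirror]; omega)
      have := linked_mirror_ladder (linked_extends hl (n := n) (by simpa using hx)
        (by rw [ladderLength_mirror]; omega) (by omega) he)
      rw [mirror_mirror] at this
      refine this.trans (H.2 hx _ ?_)
      rwa [mirror_mirror]

end Lamplighter

namespace Lamplighter

open SimpleGraph Cayley

variable {L : Type*} [Group L]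

/-! ### Word length, components and dead-ends for double-switch generators -/

theorem reach_le_of_double_adj {g h : Lamplighter (ℤ × ZMod 2) L}
    (H : (mulCayley (doubleSwitchGenerators L)).Adj g h) : h.reach ≤ max g.reach h.pos.1 := by
  rw [double_adj_iff] at H
  refine reach_le_iff.2 ⟨le_max_of_le_left g.reach_nonneg, le_max_right _ _, fun v hv => ?_⟩
  by_cases h₁ : v.1 = h.pos.1
  · exact h₁ ▸ le_max_right _ _
  · refine le_max_of_le_left ?_
    by_cases h₂ : v.1 = g.pos.1
    · exact h₂ ▸ g.pos_le_reach
    · exact le_reach (by rwa [H.2 v h₂ h₁])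

theorem reach_ge_of_double_adj {g h : Lamplighter (ℤ × ZMod 2) L}
    (H : (mulCayley (doubleSwitchGenerators L)).Adj g h) (hx : g.pos.1 < g.reach) :
    g.reach ≤ h.reach := by
  rw [double_adj_iff] at H
  rcases g.reach_attained with h₀ | h₀ | ⟨v, hv, h₀⟩
  · rw [h₀]; exact h.reach_nonneg
  · omega
  · by_cases h₁ : v.1 = h.pos.1
    · rw [← h₀, h₁]; exact h.pos_le_reach
    · rw [← h₀]
      exact le_reach (by rwa [← H.2 v (by omega) h₁])

theorem reach_eq_of_double_adj {g h : Lamplighter (ℤ × ZMod 2) L}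
    (H : (mulCayley (doubleSwitchGenerators L)).Adj g h) (hx : g.pos.1 < g.reach) :
    h.reach = g.reach := by
  have h₁ := reach_le_of_double_adj H
  have h₂ := reach_ge_of_double_adj H hx
  have h₃ := (double_adj_iff.1 H).1
  omega

open Classical in
/-- The length for the double-switch generators: that of a shortest walk on `ℤ` from the origin to
the position which covers the hull. The exception is that of the nontrivial elements supported on
the column of the origin: this walk would have no steps, but two are needed, to leave the column and
to come back. -/
noncomputable def tripLength (g : Lamplighter (ℤ × ZMod 2) L) : ℕ :=
  if g.reach = 0 ∧ g.mirror.reach = 0 ∧ g ≠ 1 then 2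
  else (2 * (g.reach + g.mirror.reach) - g.pos.1.natAbs).toNat

theorem reach_one : (1 : Lamplighter (ℤ × ZMod 2) L).reach = 0 :=
  le_antisymm (reach_le_iff.2 ⟨le_rfl, le_rfl, fun _ hv => absurd rfl hv⟩) (reach_nonneg _)

theorem neg_pos_le_reach_mirror (g : Lamplighter (ℤ × ZMod 2) L) : -g.pos.1 ≤ g.mirror.reach :=
  g.mirror.pos_le_reach

theorem tripLength_cases (g : Lamplighter (ℤ × ZMod 2) L) :
    (g.reach = 0 ∧ g.mirror.reach = 0 ∧ g ≠ 1 ∧ tripLength g = 2) ∨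
    ((g = 1 ∨ 0 < g.reach ∨ 0 < g.mirror.reach) ∧
      (tripLength g : ℤ) = 2 * (g.reach + g.mirror.reach) - g.pos.1.natAbs) := by
  have h₁ := g.reach_nonneg
  have h₂ := g.mirror.reach_nonneg
  have h₃ := g.pos_le_reach
  have h₄ := g.neg_pos_le_reach_mirror
  rw [tripLength]
  split_ifs with h
  · exact Or.inl ⟨h.1, h.2.1, h.2.2, rfl⟩
  · refine Or.inr ⟨?_, by omega⟩
    by_cases h' : g = 1
    · exact Or.inl h'
    · have : ¬ (g.reach = 0 ∧ g.mirror.reach = 0) := fun h'' => h ⟨h''.1, h''.2, h'⟩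
      omega

theorem tripLength_le {g : Lamplighter (ℤ × ZMod 2) L} {a b : ℤ} (hb : g.reach ≤ b)
    (ha : g.mirror.reach ≤ a) (h : g = 1 ∨ 0 < a + b) :
    (tripLength g : ℤ) ≤ 2 * (b + a) - g.pos.1.natAbs := by
  have h₁ := g.reach_nonneg
  have h₂ := g.mirror.reach_nonneg
  have h₃ := g.pos_le_reach
  have h₄ := g.neg_pos_le_reach_mirror
  rcases tripLength_cases g with ⟨h₅, h₆, h₇, h₈⟩ | ⟨-, h₅⟩
  · rcases h with h | h
    · exact absurd h h₇
    · omega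
  · omega

theorem tripLength_mirror (g : Lamplighter (ℤ × ZMod 2) L) :
    tripLength g.mirror = tripLength g := by
  have : g.mirror ≠ 1 ↔ g ≠ 1 := by
    refine not_congr ⟨fun h => ?_, fun h => ?_⟩
    · rw [← mirror_mirror g, h, mirror_one]
    · rw [h, mirror_one]
  rw [tripLength, tripLength, mirror_mirror]
  split_ifs with h h' h'
  · rfl
  · exact absurd ⟨h.2.1, h.1, this.1 h.2.2⟩ h'
  · exact absurd ⟨h'.2.1, h'.1, this.2 h'.2.2⟩ h
  · simp [add_comm]

theorem tripLength_le_succ {g h : Lamplighter (ℤ × ZMod 2) L}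
    (H : (mulCayley (doubleSwitchGenerators L)).Adj g h) :
    tripLength h ≤ tripLength g + 1 := by
  have h₁ := reach_le_of_double_adj H
  have h₂ := reach_le_of_double_adj (double_adj_mirror _ _ H)
  have h₃ := (double_adj_iff.1 H).1
  simp only [mirror_pos, flip_fst] at h₂
  have := g.reach_nonneg
  have := g.mirror.reach_nonneg
  have := g.pos_le_reach
  have := g.neg_pos_le_reach_mirror
  have := h.reach_nonneg
  have := h.mirror.reach_nonneg
  have := h.pos_le_reach
  have := h.neg_pos_le_reach_mirror
  have hone : ∀ k : Lamplighter (ℤ × ZMod 2) L, k = 1 → k.reach = 0 ∧ k.mirror.reach = 0 := by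
    rintro k rfl
    rw [mirror_one]
    exact ⟨reach_one, reach_one⟩
  rcases tripLength_cases g with ⟨e₁, e₂, -, e₃⟩ | ⟨-, e₁⟩ <;>
  rcases tripLength_cases h with ⟨f₁, f₂, -, f₃⟩ | ⟨-, f₁⟩ <;> omega

theorem exists_tripLength_lt {g : Lamplighter (ℤ × ZMod 2) L} (hx : 0 ≤ g.pos.1)
    (hg : g.pos.1 < g.reach ∨ 0 < g.pos.1 ∨ (g.reach = 0 ∧ g.mirror.reach = 0 ∧ g ≠ 1)) :
    ∃ h, (mulCayley (doubleSwitchGenerators L)).Adj g h ∧ tripLength h < tripLength g := by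
  have hb := g.reach_nonneg
  have ha := g.mirror.reach_nonneg
  have hxb := g.pos_le_reach
  have hxa := g.neg_pos_le_reach_mirror
  by_cases hlt : g.pos.1 < g.reach
  · have hadj : (mulCayley (doubleSwitchGenerators L)).Adj g
        (g.modify (g.pos.1 + 1, 0) ∅ fun _ => 1) := by
      rw [double_adj_iff]
      exact ⟨Or.inl rfl, fun v _ _ => by simp [modify_lamp]⟩
    refine ⟨_, hadj, ?_⟩
    have h₁ := reach_le_of_double_adj hadj
    have h₂ := reach_le_of_double_adj (double_adj_mirror _ _ hadj)
    simp only [modify_pos, mirror_pos, flip_fst] at h₁ h₂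
    have h₃ := tripLength_le (h₁.trans (max_le le_rfl (by omega))) (h₂.trans (max_le le_rfl
      (by omega))) (Or.inr (by omega))
    simp only [modify_pos] at h₃
    rcases tripLength_cases g with h₄ | ⟨-, h₄⟩ <;> omega
  · by_cases hpos : 0 < g.pos.1
    · by_cases hsmall : g.reach = 1 ∧ g.mirror.reach = 0
      · have hadj : (mulCayley (doubleSwitchGenerators L)).Adj g 1 := by
          rw [double_adj_iff]
          refine ⟨Or.inr ?_, fun v hv hv' => ?_⟩
          · simp only [one_pos', Prod.fst_zero]
            omega
          · simp only [one_pos', Prod.fst_zero] at hv'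
            by_contra hne
            have h₁ := le_reach hne
            have h₂ : (flip v).1 ≤ g.mirror.reach := le_reach (by simpa using hne)
            simp only [flip_fst] at h₂
            omega
        refine ⟨1, hadj, ?_⟩
        have h₁ : tripLength (1 : Lamplighter (ℤ × ZMod 2) L) = 0 := by
          simp [tripLength, reach_one]
        rcases tripLength_cases g with h₄ | ⟨-, h₄⟩ <;> omega
      · have hadj : (mulCayley (doubleSwitchGenerators L)).Adj g
            (g.modify (g.pos.1 - 1, 0) (columns g.pos.1 g.pos.1) fun _ => 1) := by
          rw [double_adj_iff]
          refine ⟨Or.inr (by simp), fun v hv _ => ?_⟩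
          rw [modify_lamp, if_neg]
          rw [mem_columns]
          omega
        refine ⟨_, hadj, ?_⟩
        have h₂ := reach_le_of_double_adj (double_adj_mirror _ _ hadj)
        simp only [modify_pos, mirror_pos, flip_fst] at h₂
        have h₃ := tripLength_le (g := g.modify (g.pos.1 - 1, 0) (columns g.pos.1 g.pos.1)
          fun _ => 1) (b := g.reach - 1) (reach_le_iff.2 ⟨by omega,
          by simp only [modify_pos]; omega, fun v hv => by
            rw [modify_lamp] at hv
            split_ifs at hv with hv'
            · exact absurd rfl hv
            · have := le_reach hv
              rw [mem_columns] at hv'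
              omega⟩) (h₂.trans (max_le le_rfl (by omega))) (Or.inr (by omega))
        simp only [modify_pos] at h₃
        rcases tripLength_cases g with h₄ | ⟨-, h₄⟩ <;> omega
    · obtain ⟨h₁, h₂, h₃⟩ : g.reach = 0 ∧ g.mirror.reach = 0 ∧ g ≠ 1 := by
        rcases hg with h | h | h
        exacts [absurd h hlt, absurd h hpos, h]
      have hadj : (mulCayley (doubleSwitchGenerators L)).Adj g (walk (1, 0)) := by
        rw [double_adj_iff]
        refine ⟨Or.inl (by simp only [walk]; omega), fun v hv hv' => ?_⟩
        simp only [walk]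
        by_contra hne
        have h₅ := le_reach hne
        have h₆ : (flip v).1 ≤ g.mirror.reach := le_reach (by simpa using hne)
        simp only [flip_fst] at h₆
        omega
      refine ⟨_, hadj, ?_⟩
      have e₁ := reach_le_of_double_adj hadj
      have e₂ := reach_le_of_double_adj (double_adj_mirror _ _ hadj)
      have e₃ : (walk (1, 0) : Lamplighter (ℤ × ZMod 2) L).pos.1 = 1 := rfl
      simp only [mirror_pos, flip_fst, e₃] at e₁ e₂
      have e₄ := tripLength_le (e₁.trans (max_le (c := 1) (by omega) le_rfl))
        (e₂.trans (max_le (c := 0) (by omega) (by omega))) (Or.inr (by omega))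
      rw [e₃] at e₄
      rcases tripLength_cases g with h₄ | ⟨h₄, -⟩
      · omega
      · rcases h₄ with h | h | h
        · exact absurd h h₃
        · omega
        · omega

/-- The double-switch generators generate, and `tripLength` is the word length. -/
theorem double_metric (L : Type*) [Group L] :
    (mulCayley (doubleSwitchGenerators L)).Connected ∧
      Subgroup.closure (doubleSwitchGenerators L) = ⊤ ∧
      ∀ g : Lamplighter (ℤ × ZMod 2) L, wordLength (doubleSwitchGenerators L) g = tripLength g := by
  have h_zero : ∀ g : Lamplighter (ℤ × ZMod 2) L, tripLength g = 0 → g = 1 := by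
    intro g hg
    have := g.reach_nonneg
    have := g.mirror.reach_nonneg
    have := g.pos_le_reach
    have := g.neg_pos_le_reach_mirror
    rcases tripLength_cases g with h | ⟨h₁, h₂⟩
    · omega
    · rcases h₁ with h | h | h
      · exact h
      · omega
      · omega
  refine wordLength_eq_of_descent (by simp [tripLength, reach_one]) h_zero
    (fun g h => tripLength_le_succ) fun g k hg => ?_
  have key : ∃ h, (mulCayley (doubleSwitchGenerators L)).Adj g h ∧
      tripLength h < tripLength g := by
    have hg0 : g ≠ 1 := by
      rintro rfl
      simp [tripLength, reach_one] at hg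
    have h₁ := g.reach_nonneg
    have h₂ := g.mirror.reach_nonneg
    have hm0 : g.mirror ≠ 1 := fun h => hg0 (by rw [← mirror_mirror g, h, mirror_one])
    by_cases h : 0 < g.pos.1 ∨ (g.pos.1 = 0 ∧ (0 < g.reach ∨ g.mirror.reach = 0))
    · refine exists_tripLength_lt (by omega) ?_
      by_cases h' : g.reach = 0 ∧ g.mirror.reach = 0
      · exact Or.inr (Or.inr ⟨h'.1, h'.2, hg0⟩)
      · omega
    · obtain ⟨h, hadj, hlt⟩ := exists_tripLength_lt (g := g.mirror)
        (by simp only [mirror_pos, flip_fst]; omega) (by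
          simp only [mirror_pos, flip_fst]
          omega)
      refine ⟨h.mirror, ?_, ?_⟩
      · have := double_adj_mirror _ _ hadj
        rwa [mirror_mirror] at this
      · rw [tripLength_mirror]
        rwa [tripLength_mirror] at hlt
  obtain ⟨h, hadj, hlt⟩ := key
  have := tripLength_le_succ hadj.symm
  exact ⟨h, hadj, by omega⟩

theorem wordLength_double (g : Lamplighter (ℤ × ZMod 2) L) :
    wordLength (doubleSwitchGenerators L) g = tripLength g := (double_metric L).2.2 g

theorem tripLength_eq {g : Lamplighter (ℤ × ZMod 2) L} {a b : ℤ} (hb : g.reach = b)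
    (ha : g.mirror.reach = a) (h : 0 < a + b) :
    (tripLength g : ℤ) = 2 * (b + a) - g.pos.1.natAbs := by
  rcases tripLength_cases g with h' | ⟨-, h'⟩ <;> omega

theorem mem_double_annulus {g : Lamplighter (ℤ × ZMod 2) L} {lo hi : ℕ} :
    g ∈ annulus (doubleSwitchGenerators L) lo hi ↔ lo ≤ tripLength g ∧ tripLength g ≤ hi := by
  rw [← wordLength_double]; rfl

/-- With both extremities of the hull too far away, the element is confined to the finite set of the
elements with the same hull. -/
theorem notMem_infinitePart_double [Finite L] {n : ℕ} (hn : 2 ≤ n)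
    {g : Lamplighter (ℤ × ZMod 2) L} (h₁ : g.reach + 2 * g.mirror.reach < n)
    (h₂ : 2 * g.reach + g.mirror.reach < n) : g ∉ infinitePart (doubleSwitchGenerators L) n := by
  set b := g.reach with hb
  set a := g.mirror.reach with ha
  have hfin : {h : Lamplighter (ℤ × ZMod 2) L | h.reach = b ∧ h.mirror.reach = a}.Finite := by
    have hmem : ∀ h : Lamplighter (ℤ × ZMod 2) L, h.reach = b → h.mirror.reach = a →
        h.pos ∈ columns (-a) b ∧ ∀ v, v ∉ columns (-a) b → h.lamp v = 1 := by
      intro h hb' ha'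
      have e₁ := h.pos_le_reach
      have e₂ := h.neg_pos_le_reach_mirror
      refine ⟨by rw [mem_columns]; omega, fun v hv => ?_⟩
      by_contra hne
      have e₃ := le_reach hne
      have e₄ : (flip v).1 ≤ h.mirror.reach := le_reach (by simpa using hne)
      rw [mem_columns] at hv
      simp only [flip_fst] at e₄
      omega
    refine Set.Finite.of_injOn (f := fun h : Lamplighter (ℤ × ZMod 2) L =>
      (h.pos, fun v : columns (-a) b => h.lamp v))
      (t := (columns (-a) b : Set (ℤ × ZMod 2)) ×ˢ Set.univ) ?_ ?_
      ((Finset.finite_toSet _).prod Set.finite_univ)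
    · rintro h ⟨hb', ha'⟩
      exact ⟨(hmem h hb' ha').1, trivial⟩
    · rintro h ⟨hb', ha'⟩ h' ⟨hb'', ha''⟩ heq
      simp only [Prod.mk.injEq] at heq
      have hlamp : h.lamp = h'.lamp := by
        funext v
        by_cases hv : v ∈ columns (-a) b
        · exact congrFun heq.2 ⟨v, hv⟩
        · rw [(hmem h hb' ha').2 v hv, (hmem h' hb'' ha'').2 v hv]
      exact Lamplighter.ext heq.1 hlamp
  intro hg
  refine hg (hfin.subset fun h hh => ?_)
  refine (mem_outerComponent_iff.1 hh).2.invariant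
    (P := fun h => h.reach = b ∧ h.mirror.reach = a) ?_ ⟨rfl, rfl⟩
  intro c d hcd hc hd hK
  have hc : n ≤ tripLength c := by rw [← wordLength_double]; exact hc
  have hd : n ≤ tripLength d := by rw [← wordLength_double]; exact hd
  obtain ⟨hcb, hca⟩ := hK
  have e₁ := c.reach_nonneg
  have e₂ := c.mirror.reach_nonneg
  have e₃ := c.pos_le_reach
  have e₄ := c.neg_pos_le_reach_mirror
  have hstep := (double_adj_iff.1 hcd).1
  rcases tripLength_cases c with ⟨f₁, f₂, -, f₃⟩ | ⟨-, f₁⟩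
  · -- switching the lamps of the central column takes two steps through a shorter element
    have k₁ := reach_le_of_double_adj hcd
    have k₂ := reach_le_of_double_adj (double_adj_mirror _ _ hcd)
    simp only [mirror_pos, flip_fst] at k₂
    have := tripLength_le k₁ k₂ (Or.inr (by omega))
    omega
  · have k₁ := reach_eq_of_double_adj hcd (by omega)
    have k₂ := reach_eq_of_double_adj (double_adj_mirror _ _ hcd)
      (by simp only [mirror_pos, flip_fst]; omega)
    exact ⟨by omega, by omega⟩

theorem exists_deadEnd_double [Finite L] [Nontrivial L] (d : ℕ) :
    ∃ g : Lamplighter (ℤ × ZMod 2) L, IsDeadEnd (doubleSwitchGenerators L) g ∧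
      (d : ℕ∞) ≤ retreatDepth (doubleSwitchGenerators L) g := by
  obtain ⟨l, hl⟩ := exists_ne (1 : L)
  set m : ℤ := d + 1 with hm
  let g : Lamplighter (ℤ × ZMod 2) L :=
    (1 : Lamplighter (ℤ × ZMod 2) L).modify 0 {(m, 0), (-m, 0)} fun _ => l
  have hlamp : ∀ v, g.lamp v ≠ 1 ↔ v = (m, 0) ∨ v = (-m, 0) := by
    intro v
    simp only [g, modify_lamp, Finset.mem_insert, Finset.mem_singleton]
    split_ifs with h <;> simp [h, hl]
  have hb : g.reach = m := by
    refine le_antisymm (reach_le_iff.2 ⟨by omega, ?_, fun v hv => ?_⟩) ?_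
    · change (0 : ℤ) ≤ m
      omega
    · rcases (hlamp v).1 hv with rfl | rfl
      · exact le_rfl
      · simp only; omega
    · exact le_reach (v := (m, 0)) ((hlamp _).2 (Or.inl rfl))
  have ha : g.mirror.reach = m := by
    refine le_antisymm (reach_le_iff.2 ⟨by omega, ?_, fun v hv => ?_⟩) ?_
    · change -(0 : ℤ) ≤ m
      omega
    · rcases (hlamp (flip v)).1 hv with h | h
      · have := congrArg Prod.fst h
        simp only [flip_fst] at this
        omega
      · have := congrArg Prod.fst h
        simp only [flip_fst] at this
        omega
    · exact le_reach (v := (m, 0)) ((hlamp _).2 (Or.inr rfl))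
  have hx : g.pos.1 = 0 := rfl
  have hlen := tripLength_eq hb ha (by omega)
  rw [hx] at hlen
  refine ⟨g, fun h hadj => ?_, ?_⟩
  · rw [wordLength_double, wordLength_double]
    have k₁ := reach_eq_of_double_adj hadj (by omega)
    have k₂ := reach_eq_of_double_adj (double_adj_mirror _ _ hadj)
      (by simp only [mirror_pos, flip_fst]; omega)
    have := tripLength_eq (k₁.trans hb) (k₂.trans ha) (by omega)
    omega
  · refine le_sInf ?_
    rintro _ ⟨r, hr, rfl⟩
    rw [Nat.cast_le]
    by_contra hlt
    change g ∈ infinitePart _ (wordLength _ g - r) at hr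
    rw [wordLength_double] at hr
    exact notMem_infinitePart_double (by omega) (by omega) (by omega) hr

end Lamplighter

namespace Lamplighter

open SimpleGraph Cayley

variable {L : Type*} [Group L]

/-! ### The connection thickness for double-switch generators -/

theorem reach_le_reach {g h : Lamplighter (ℤ × ZMod 2) L} (hx : g.pos.1 ≤ h.reach)
    (hlamp : ∀ v, g.lamp v ≠ 1 → h.lamp v ≠ 1) : g.reach ≤ h.reach :=
  reach_le_iff.2 ⟨h.reach_nonneg, hx, fun v hv => le_reach (hlamp v hv)⟩

theorem reach_walk (c : ℤ) :
    (walk (c, 0) : Lamplighter (ℤ × ZMod 2) L).reach = max 0 c :=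
  le_antisymm
    (reach_le_iff.2 ⟨le_max_left _ _, le_max_right _ _, fun _ hv => absurd rfl hv⟩)
    (max_le (reach_nonneg _) (pos_le_reach (walk (c, 0))))

theorem mirror_walk (c : ℤ) :
    (walk (c, 0) : Lamplighter (ℤ × ZMod 2) L).mirror = walk (-c, 0) := rfl

theorem tripLength_walk (c : ℤ) :
    tripLength (walk (c, 0) : Lamplighter (ℤ × ZMod 2) L) = c.natAbs := by
  have h₁ := reach_walk (L := L) c
  have h₂ := reach_walk (L := L) (-c)
  rw [← mirror_walk] at h₂
  have h₃ : (walk (c, 0) : Lamplighter (ℤ × ZMod 2) L).pos.1 = c := rfl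
  rcases tripLength_cases (walk (c, 0) : Lamplighter (ℤ × ZMod 2) L) with ⟨e₁, e₂, e₃, -⟩ | ⟨-, e⟩
  · have : c = 0 := by omega
    subst this
    exact absurd rfl e₃
  · omega

theorem linked_mirror_double {lo hi : ℕ} {g h : Lamplighter (ℤ × ZMod 2) L}
    (H : Linked (doubleSwitchGenerators L) (annulus (doubleSwitchGenerators L) lo hi) g h) :
    Linked (doubleSwitchGenerators L) (annulus (doubleSwitchGenerators L) lo hi)
      g.mirror h.mirror := by
  refine H.map double_adj_mirror fun a ha => ?_
  rw [mem_double_annulus] at ha ⊢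
  rwa [tripLength_mirror]

theorem walk_mem_infinitePart (n : ℕ) :
    (walk ((n : ℤ), 0) : Lamplighter (ℤ × ZMod 2) L) ∈
      infinitePart (doubleSwitchGenerators L) n := by
  have hout : ∀ t : ℕ, (walk ((n : ℤ) + t, 0) : Lamplighter (ℤ × ZMod 2) L) ∈
      outerSet (doubleSwitchGenerators L) n := by
    intro t
    change n ≤ wordLength _ _
    rw [wordLength_double, tripLength_walk]
    omega
  have hlink : ∀ t : ℕ, (walk ((n : ℤ) + t, 0) : Lamplighter (ℤ × ZMod 2) L) ∈
      outerComponent (doubleSwitchGenerators L) n (walk ((n : ℤ), 0)) := by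
    intro t
    rw [mem_outerComponent_iff]
    refine ⟨by simpa using hout 0, ?_⟩
    induction t with
    | zero => simpa using Linked.refl _
    | succ t ih =>
      refine ih.trans (Linked.of_adj ?_ (hout t) (hout (t + 1)))
      rw [double_adj_iff]
      refine ⟨Or.inl ?_, fun v _ _ => rfl⟩
      simp only [walk]
      push_cast
      ring
  refine Set.infinite_of_injective_forall_mem (f := fun t : ℕ =>
    (walk ((n : ℤ) + t, 0) : Lamplighter (ℤ × ZMod 2) L)) (fun s t hst => ?_) hlink
  have := congrArg (fun h => h.pos.1) hst
  simpa [walk] using this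

theorem walk_neg_mem_infinitePart (n : ℕ) :
    (walk (-(n : ℤ), 0) : Lamplighter (ℤ × ZMod 2) L) ∈
      infinitePart (doubleSwitchGenerators L) n := by
  rw [← mirror_walk]
  refine infinitePart_involution double_adj_mirror mirror_mirror (fun a => ?_)
    (walk_mem_infinitePart n)
  rw [wordLength_double, wordLength_double, tripLength_mirror]

/-- In a too thin annulus, an element which reaches the column `n` on the right, with nothing on the
left of the origin, remains so, except for visits to the column `-1`: getting closer than `n` on the
right would require being there with something on the left, and going further to the left would
make the length exceed `2 n + 1`. -/
theorem not_linked_walk {n r : ℕ} (hn : 2 ≤ n) (hr : r < n + 2) :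
    ¬ Linked (doubleSwitchGenerators L) (annulus (doubleSwitchGenerators L) n (n + r))
      (walk ((n : ℤ), 0)) (walk (-(n : ℤ), 0)) := by
  intro H
  have key := H.invariant (P := fun g => (n : ℤ) ≤ g.reach ∧
    (g.mirror.reach = 0 ∨ (g.pos.1 = -1 ∧ g.mirror.reach = 1))) ?_ ?_
  · have := key.1
    rw [reach_walk] at this
    omega
  · rintro c d hcd hc hd ⟨hcn, hca⟩
    rw [mem_double_annulus] at hc hd
    have hstep := (double_adj_iff.1 hcd).1
    have b₁ := reach_le_of_double_adj hcd
    have b₂ : c.pos.1 < c.reach → c.reach ≤ d.reach := reach_ge_of_double_adj hcd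
    have a₁ := reach_le_of_double_adj (double_adj_mirror _ _ hcd)
    simp only [mirror_pos, flip_fst] at a₁
    have := c.pos_le_reach
    have := c.neg_pos_le_reach_mirror
    have := d.pos_le_reach
    have := d.neg_pos_le_reach_mirror
    have := d.reach_nonneg
    have := d.mirror.reach_nonneg
    have hd' : 1 ≤ d.reach := by
      by_cases h : c.pos.1 < c.reach
      · have := b₂ h
        omega
      · omega
    have hlen := tripLength_eq (g := d) rfl rfl (by omega)
    by_cases h : c.pos.1 < c.reach
    · have := b₂ h
      omega
    · omega
  · rw [mirror_walk, reach_walk, reach_walk]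
    omega

/-- Walk to any column of the hull, lighting a lamp in each column which is left, so as to keep the
hull. -/
theorem exists_linked_same_hull {l : L} (hl : l ≠ 1) {lo hi : ℕ} {a b y : ℤ} (hab : 0 < a + b)
    (hya : -a ≤ y) (hyb : y ≤ b) {g : Lamplighter (ℤ × ZMod 2) L} (hb : g.reach = b)
    (ha : g.mirror.reach = a)
    (hlen : ∀ c : ℤ, (g.pos.1 ≤ c ∧ c ≤ y) ∨ (y ≤ c ∧ c ≤ g.pos.1) →
      (lo : ℤ) ≤ 2 * (b + a) - c.natAbs ∧ 2 * (b + a) - (c.natAbs : ℤ) ≤ hi) :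
    ∃ h, Linked (doubleSwitchGenerators L) (annulus (doubleSwitchGenerators L) lo hi) g h ∧
      h.pos.1 = y ∧ h.reach = b ∧ h.mirror.reach = a := by
  induction hm : (y - g.pos.1).natAbs generalizing g with
  | zero => exact ⟨g, Linked.refl _, by omega, hb, ha⟩
  | succ m ih =>
    obtain ⟨x', hx', hm'⟩ : ∃ x' : ℤ, (x' = g.pos.1 + 1 ∧ x' ≤ y ∨ g.pos.1 = x' + 1 ∧ y ≤ x') ∧
        (y - x').natAbs = m := by
      rcases lt_or_ge g.pos.1 y with h | h
      · exact ⟨g.pos.1 + 1, by omega, by omega⟩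
      · exact ⟨g.pos.1 - 1, by omega, by omega⟩
    have hadj : (mulCayley (doubleSwitchGenerators L)).Adj g
        (g.modify (x', 0) {(g.pos.1, 0)} fun _ => l) := by
      rw [double_adj_iff]
      refine ⟨by simp only [modify_pos]; omega, fun v hv _ => ?_⟩
      rw [modify_lamp, if_neg]
      simp only [Finset.mem_singleton]
      rintro rfl
      exact hv rfl
    set h := g.modify (x', 0) {(g.pos.1, 0)} fun _ => l with hh
    have hhx : h.pos.1 = x' := rfl
    have hlamp : ∀ v, g.lamp v ≠ 1 → h.lamp v ≠ 1 := by
      intro v hv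
      rw [hh, modify_lamp]
      split_ifs
      exacts [hl, hv]
    have hnew : h.lamp (g.pos.1, 0) ≠ 1 := by
      simpa [hh, modify_lamp] using hl
    have b₁ := reach_le_of_double_adj hadj
    have a₁ := reach_le_of_double_adj (double_adj_mirror _ _ hadj)
    simp only [mirror_pos, flip_fst, hhx] at b₁ a₁
    have b₂ : g.reach ≤ h.reach := 
      reach_le_reach (le_reach (v := (g.pos.1, 0)) hnew) hlamp
    have a₂ : g.mirror.reach ≤ h.mirror.reach := by
      refine reach_le_reach ?_ (fun v => hlamp (flip v))
      exact le_reach (g := h.mirror) (v := (-g.pos.1, 0)) (by simpa [flip] using hnew)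
    have := g.pos_le_reach
    have := g.neg_pos_le_reach_mirror
    have hb' : h.reach = b := by omega
    have ha' : h.mirror.reach = a := by omega
    obtain ⟨k, hk, hk'⟩ := ih hb' ha' (fun c hc => hlen c (by omega)) (by omega)
    refine ⟨k, (Linked.of_adj hadj ?_ ?_).trans hk, hk'⟩
    · have e := tripLength_eq hb ha (by omega)
      have := hlen g.pos.1 (by omega)
      exact mem_double_annulus.2 ⟨by omega, by omega⟩
    · have e := tripLength_eq hb' ha' (by omega)
      have := hlen x' (by omega)
      exact mem_double_annulus.2 ⟨by omega, by omega⟩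

/-- One step to the right from the right end of the hull. -/
theorem exists_adj_extend {g : Lamplighter (ℤ × ZMod 2) L} (hx : g.pos.1 = g.reach)
    (ha : -g.pos.1 < g.mirror.reach) :
    ∃ h, (mulCayley (doubleSwitchGenerators L)).Adj g h ∧ h.pos.1 = g.reach + 1 ∧
      h.reach = g.reach + 1 ∧ h.mirror.reach = g.mirror.reach := by
  have hadj : (mulCayley (doubleSwitchGenerators L)).Adj g
      (g.modify (g.pos.1 + 1, 0) ∅ fun _ => 1) := by
    rw [double_adj_iff]
    exact ⟨Or.inl rfl, fun v _ _ => by simp [modify_lamp]⟩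
  refine ⟨_, hadj, by simp [hx], le_antisymm ?_ ?_, ?_⟩
  · refine (reach_le_of_double_adj hadj).trans ?_
    simp only [modify_pos]
    omega
  · have := pos_le_reach (g.modify (g.pos.1 + 1, 0) ∅ fun _ => 1)
    simp only [modify_pos] at this
    omega
  · exact reach_eq_of_double_adj (double_adj_mirror _ _ hadj) (by simpa using ha)

/-- One step to the left from the right end of the hull, after switching off the lamps there. -/
theorem exists_adj_shrink {g : Lamplighter (ℤ × ZMod 2) L} (hx : g.pos.1 = g.reach)
    (h0 : 0 < g.reach) :
    ∃ h, (mulCayley (doubleSwitchGenerators L)).Adj g h ∧ h.pos.1 = g.reach - 1 ∧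
      h.reach = g.reach - 1 ∧ h.mirror.reach = g.mirror.reach := by
  have hadj : (mulCayley (doubleSwitchGenerators L)).Adj g
      (g.modify (g.pos.1 - 1, 0) (columns g.pos.1 g.pos.1) fun _ => 1) := by
    rw [double_adj_iff]
    refine ⟨Or.inr (by simp), fun v hv _ => ?_⟩
    rw [modify_lamp, if_neg]
    rw [mem_columns]
    omega
  refine ⟨_, hadj, by simp [hx], le_antisymm ?_ ?_, ?_⟩
  · refine reach_le_iff.2 ⟨by omega, by simp only [modify_pos]; omega, fun v hv => ?_⟩
    rw [modify_lamp] at hv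
    split_ifs at hv with hv'
    · exact absurd rfl hv
    · have := le_reach hv
      rw [mem_columns] at hv'
      omega
  · have := pos_le_reach (g.modify (g.pos.1 - 1, 0) (columns g.pos.1 g.pos.1) fun _ => 1)
    simp only [modify_pos] at this
    omega
  · have := g.mirror.reach_nonneg
    exact reach_eq_of_double_adj (double_adj_mirror _ _ hadj)
      (by simp only [mirror_pos, flip_fst]; omega)

/-- At the right end of the hull, the total width of the hull can be adjusted to `n + 1`. -/
theorem exists_linked_width {n : ℕ} (hn : 2 ≤ n) {g : Lamplighter (ℤ × ZMod 2) L} {a : ℤ}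
    (hx : g.pos.1 = g.reach) (ha : g.mirror.reach = a) (h₁ : (n : ℤ) ≤ g.reach + 2 * a)
    (h₂ : g.reach + 2 * a ≤ 2 * n + 2) :
    ∃ h, Linked (doubleSwitchGenerators L) (annulus (doubleSwitchGenerators L) n (n + (n + 2)))
      g h ∧ h.pos.1 = n + 1 - a ∧ h.reach = n + 1 - a ∧ h.mirror.reach = a := by
  induction hm : (g.reach - (n + 1 - a)).natAbs generalizing g with
  | zero => exact ⟨g, Linked.refl _, by omega, by omega, ha⟩
  | succ m ih =>
    have hb0 := g.reach_nonneg
    have ha0 := g.mirror.reach_nonneg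
    have hg := tripLength_eq (g := g) rfl ha (by omega)
    have H : ∃ h, (mulCayley (doubleSwitchGenerators L)).Adj g h ∧ h.pos.1 = h.reach ∧
        h.mirror.reach = a ∧ (g.reach < n + 1 - a ∧ h.reach = g.reach + 1 ∨
          n + 1 - a < g.reach ∧ h.reach = g.reach - 1) := by
      rcases lt_or_ge g.reach (n + 1 - a) with h | h
      · obtain ⟨k, hk, hk₁, hk₂, hk₃⟩ := exists_adj_extend hx (by omega)
        exact ⟨k, hk, by omega, by omega, by omega⟩
      · obtain ⟨k, hk, hk₁, hk₂, hk₃⟩ := exists_adj_shrink hx (by omega)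
        exact ⟨k, hk, by omega, by omega, by omega⟩
    obtain ⟨h, hadj, hhx, hha, hhb⟩ := H
    have hh := tripLength_eq (g := h) rfl hha (by omega)
    obtain ⟨k, hk, hk'⟩ := ih hhx hha (by omega) (by omega) (by omega)
    exact ⟨k, (Linked.of_adj hadj (mem_double_annulus.2 ⟨by omega, by omega⟩)
      (mem_double_annulus.2 ⟨by omega, by omega⟩)).trans hk, hk'⟩

/-- The element at the origin whose only lit lamp is at the column `n + 1`. -/
noncomputable def farLamp (l : L) (n : ℕ) : Lamplighter (ℤ × ZMod 2) L :=
  (1 : Lamplighter (ℤ × ZMod 2) L).modify 0 {((n : ℤ) + 1, 0)} fun _ => l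

theorem farLamp_lamp (l : L) (n : ℕ) (v) :
    (farLamp l n).lamp v = if v = ((n : ℤ) + 1, 0) then l else 1 := by
  simp [farLamp, modify_lamp]

theorem farLamp_pos (l : L) (n : ℕ) : (farLamp l n).pos = 0 := rfl

theorem reach_farLamp {l : L} (hl : l ≠ 1) (n : ℕ) : (farLamp l n).reach = n + 1 := by
  refine le_antisymm (reach_le_iff.2 ⟨by omega, ?_, fun v hv => ?_⟩) ?_
  · simp only [farLamp_pos, Prod.fst_zero]
    omega
  · rw [farLamp_lamp] at hv
    split_ifs at hv with h
    · rw [h]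
    · exact absurd rfl hv
  · exact le_reach (v := ((n : ℤ) + 1, 0)) (by simpa [farLamp_lamp] using hl)

theorem reach_mirror_farLamp (l : L) (n : ℕ) : (farLamp l n).mirror.reach = 0 := by
  refine le_antisymm (reach_le_iff.2 ⟨le_rfl, by simp [farLamp_pos], fun v hv => ?_⟩)
    (reach_nonneg _)
  rw [mirror_lamp, farLamp_lamp] at hv
  split_ifs at hv with h
  · have := congrArg Prod.fst h
    simp only [flip_fst] at this
    omega
  · exact absurd rfl hv

/-- Walking back to the origin and switching off the lamps met. -/
theorem linked_farLamp_of_agree {l : L} (hl : l ≠ 1) {n : ℕ} (c : ℕ) (hc : c ≤ n + 1)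
    {g : Lamplighter (ℤ × ZMod 2) L} (hx : g.pos.1 = c) (ha : g.mirror.reach = 0)
    (hb : g.reach = n + 1) (hlamp : ∀ v : ℤ × ZMod 2, (c : ℤ) < v.1 →
      g.lamp v = (farLamp l n).lamp v) :
    Linked (doubleSwitchGenerators L) (annulus (doubleSwitchGenerators L) n (n + (n + 2)))
      g (farLamp l n) := by
  induction c generalizing g with
  | zero =>
    have h₁ : (mulCayley (doubleSwitchGenerators L)).Adj g
        (g.modify (1, 0) (columns 0 0) (farLamp l n).lamp) := by
      rw [double_adj_iff]
      refine ⟨Or.inl (by simp [hx]), fun v hv _ => ?_⟩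
      rw [modify_lamp, if_neg]
      rw [mem_columns]
      omega
    have h₂ : (mulCayley (doubleSwitchGenerators L)).Adj
        (g.modify (1, 0) (columns 0 0) (farLamp l n).lamp) (farLamp l n) := by
      rw [double_adj_iff]
      refine ⟨Or.inr (by simp [farLamp_pos]), fun v _ hv => ?_⟩
      rw [modify_lamp, if_neg (by simp only [farLamp_pos, Prod.fst_zero] at hv; simp; omega)]
      rcases lt_or_ge 0 v.1 with h | h
      · exact hlamp v (by exact_mod_cast h)
      · have hv0 : v.1 < 0 := lt_of_le_of_ne h hv
        have e₁ : g.lamp v = 1 := by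
          have := lamp_eq_one_of_reach_lt (g := g.mirror) (v := flip v)
            (by simp only [flip_fst]; omega)
          simpa using this
        rw [e₁, farLamp_lamp, if_neg]
        rintro rfl
        simp only at hv0
        omega
    have e₁ := reach_eq_of_double_adj h₁ (by omega)
    have e₂ := reach_le_of_double_adj (double_adj_mirror _ _ h₁)
    have e₃ := (g.modify (1, 0) (columns 0 0) (farLamp l n).lamp).mirror.reach_nonneg
    simp only [mirror_pos, flip_fst, modify_pos] at e₂
    have l₁ := tripLength_eq hb ha (by omega)
    have l₂ := tripLength_eq (e₁.trans hb) (a := 0) (by omega) (by omega)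
    have l₃ := tripLength_eq (reach_farLamp hl n) (reach_mirror_farLamp l n) (by omega)
    simp only [modify_pos, farLamp_pos, Prod.fst_zero, hx] at l₁ l₂ l₃
    have hm : g.modify (1, 0) (columns 0 0) (farLamp l n).lamp ∈
        annulus (doubleSwitchGenerators L) n (n + (n + 2)) :=
      mem_double_annulus.2 ⟨by omega, by omega⟩
    exact (Linked.of_adj h₁ (mem_double_annulus.2 ⟨by omega, by omega⟩) hm).trans
      (Linked.of_adj h₂ hm (mem_double_annulus.2 ⟨by omega, by omega⟩))
  | succ c ih =>
    push_cast at hx hlamp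
    have h₁ : (mulCayley (doubleSwitchGenerators L)).Adj g
        (g.modify ((c : ℤ), 0) (columns (c + 1) (c + 1)) (farLamp l n).lamp) := by
      rw [double_adj_iff]
      refine ⟨Or.inr (by simpa using hx), fun v hv _ => ?_⟩
      rw [modify_lamp, if_neg]
      rw [mem_columns]
      omega
    set h := g.modify ((c : ℤ), 0) (columns (c + 1) (c + 1)) (farLamp l n).lamp with hh
    have hhx : h.pos.1 = c := rfl
    have hhlamp : ∀ v : ℤ × ZMod 2, (c : ℤ) < v.1 → h.lamp v = (farLamp l n).lamp v := by
      intro v hv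
      rw [hh, modify_lamp]
      split_ifs with h'
      · rfl
      · rw [mem_columns] at h'
        exact hlamp v (by omega)
    have b₁ := reach_le_of_double_adj h₁
    have b₂ : (n : ℤ) + 1 ≤ h.reach := by
      refine le_reach (v := ((n : ℤ) + 1, 0)) ?_
      rw [hhlamp _ (by simp only; omega), farLamp_lamp, if_pos rfl]
      exact hl
    have a₁ := reach_le_of_double_adj (double_adj_mirror _ _ h₁)
    have a₂ := h.mirror.reach_nonneg
    simp only [mirror_pos, flip_fst, hhx] at a₁
    have hb' : h.reach = n + 1 := by omega
    have ha' : h.mirror.reach = 0 := by omega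
    have l₁ := tripLength_eq hb ha (by omega)
    have l₂ := tripLength_eq hb' ha' (by omega)
    refine (Linked.of_adj h₁ (mem_double_annulus.2 ⟨by omega, by omega⟩)
      (mem_double_annulus.2 ⟨by omega, by omega⟩)).trans (ih (by omega) hhx ha' hb' hhlamp)

/-- From the right end of a hull of width `n + 1`, walk to the left end to shrink the hull there,
then back to the right end to extend it, until the hull lies on the right of the origin. -/
theorem linked_farLamp_of_width {l : L} (hl : l ≠ 1) {n : ℕ} (hn : 2 ≤ n) (a : ℕ)
    {g : Lamplighter (ℤ × ZMod 2) L} (hx : g.pos.1 = n + 1 - a) (hb : g.reach = n + 1 - a)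
    (ha : g.mirror.reach = a) :
    Linked (doubleSwitchGenerators L) (annulus (doubleSwitchGenerators L) n (n + (n + 2)))
      g (farLamp l n) := by
  induction a generalizing g with
  | zero =>
    refine linked_farLamp_of_agree hl (n + 1) le_rfl (by push_cast; omega) (by simpa using ha)
      (by push_cast at hb; omega) fun v hv => ?_
    push_cast at hv hb
    rw [lamp_eq_one_of_reach_lt (by omega), lamp_eq_one_of_reach_lt]
    rw [reach_farLamp hl]
    omega
  | succ a ih =>
    push_cast at hx hb ha
    have hb0 := g.reach_nonneg
    obtain ⟨g₁, hg₁, x₁, b₁, a₁⟩ := exists_linked_same_hull hl (lo := n) (hi := n + (n + 2))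
      (y := -((a : ℤ) + 1)) (by omega) (by omega) (by omega) hb ha
      (fun c hc => by omega)
    obtain ⟨k, hk, xk, bk, ak⟩ := exists_adj_shrink (g := g₁.mirror)
      (by simp only [mirror_pos, flip_fst]; omega) (by omega)
    rw [mirror_mirror] at ak
    have hadj := double_adj_mirror _ _ hk
    rw [mirror_mirror] at hadj
    have xk' : k.mirror.pos.1 = -(a : ℤ) := by
      simp only [mirror_pos, flip_fst]
      omega
    have bk' : k.mirror.mirror.reach = a := by rw [mirror_mirror]; omega
    have len₁ := tripLength_eq b₁ a₁ (by omega)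
    have lenk := tripLength_eq (ak.trans b₁) bk' (by omega)
    obtain ⟨g₂, hg₂, x₂, b₂, a₂⟩ := exists_linked_same_hull hl (lo := n) (hi := n + (n + 2))
      (y := (n : ℤ) - a) (by omega) (by omega) (by omega) (ak.trans b₁) bk'
      (fun c hc => by omega)
    obtain ⟨g₃, h₃, x₃, b₃, a₃⟩ := exists_adj_extend (g := g₂) (by omega) (by omega)
    have len₂ := tripLength_eq b₂ a₂ (by omega)
    have len₃ := tripLength_eq b₃ (a₃.trans a₂) (by omega)
    refine hg₁.trans (Linked.trans (Linked.of_adj hadj (mem_double_annulus.2 ⟨by omega, by omega⟩)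
      (mem_double_annulus.2 ⟨by omega, by omega⟩)) (hg₂.trans (Linked.trans (Linked.of_adj h₃
      (mem_double_annulus.2 ⟨by omega, by omega⟩) (mem_double_annulus.2 ⟨by omega, by omega⟩))
      (ih (by omega) (by omega) (by omega)))))

theorem linked_farLamp_of_right {l : L} (hl : l ≠ 1) {n : ℕ} (hn : 2 ≤ n)
    {g : Lamplighter (ℤ × ZMod 2) L} (h₁ : n ≤ tripLength g) (h₂ : tripLength g ≤ 2 * n + 2)
    (h₃ : (n : ℤ) ≤ g.reach + 2 * g.mirror.reach)
    (h₄ : 0 ≤ g.pos.1 ∨ 2 * g.reach + g.mirror.reach < n) :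
    Linked (doubleSwitchGenerators L) (annulus (doubleSwitchGenerators L) n (n + (n + 2)))
      g (farLamp l n) := by
  have := g.reach_nonneg
  have := g.mirror.reach_nonneg
  have := g.pos_le_reach
  have := g.neg_pos_le_reach_mirror
  have hlen := tripLength_eq (g := g) rfl rfl (by omega)
  obtain ⟨g₁, hg₁, x₁, b₁, a₁⟩ := exists_linked_same_hull hl (lo := n) (hi := n + (n + 2))
    (g := g) (y := g.reach) (by omega) (by omega) le_rfl rfl rfl
    (fun c hc => by omega)
  obtain ⟨g₂, hg₂, x₂, b₂, a₂⟩ := exists_linked_width hn (x₁.trans b₁.symm) rfl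
    (by omega) (by omega)
  have := g₁.mirror.reach_nonneg
  exact hg₁.trans (hg₂.trans (linked_farLamp_of_width hl hn g₁.mirror.reach.toNat
    (by omega) (by omega) (by omega)))

theorem annulusInf_double_connected [Finite L] [Nontrivial L] {n : ℕ} (hn : 2 ≤ n) :
    ((mulCayley (doubleSwitchGenerators L)).induce
      (annulusInf (doubleSwitchGenerators L) n (n + 2))).Connected := by
  obtain ⟨l, hl⟩ := exists_ne (1 : L)
  have hz : tripLength (farLamp l n) = 2 * n + 2 := by
    have := tripLength_eq (reach_farLamp hl n) (reach_mirror_farLamp l n) (by omega)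
    simp only [farLamp_pos, Prod.fst_zero] at this
    omega
  refine annulusInf_connected (z := farLamp l n) ⟨?_, ?_⟩ fun g hg => ?_
  · rw [wordLength_double]
    omega
  · refine infinitePart_of_linked (walk_mem_infinitePart n) (Linked.mono (A := annulus _ n
      (n + (n + 2))) (fun _ h => h.1) (linked_farLamp_of_right hl hn ?_ ?_ ?_ (Or.inl ?_)))
    · rw [tripLength_walk]; omega
    · rw [tripLength_walk]; omega
    · rw [mirror_walk, reach_walk, reach_walk]; omega
    · simp [walk]
  · have hinf : (n : ℤ) ≤ g.reach + 2 * g.mirror.reach ∨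
        (n : ℤ) ≤ 2 * g.reach + g.mirror.reach := by
      by_contra hcon
      exact notMem_infinitePart_double hn (by omega) (by omega) hg.2
    obtain ⟨h₁, h₂⟩ := mem_double_annulus.1 (annulusInf_subset _ _ hg)
    by_cases hright : (n : ℤ) ≤ g.reach + 2 * g.mirror.reach ∧
        (0 ≤ g.pos.1 ∨ 2 * g.reach + g.mirror.reach < n)
    · exact linked_farLamp_of_right hl hn h₁ (by omega) hright.1 hright.2
    · have := linked_mirror_double (linked_farLamp_of_right hl hn (g := g.mirror)
        (by rwa [tripLength_mirror]) (by rw [tripLength_mirror]; omega)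
        (by rw [mirror_mirror]; omega)
        (by rw [mirror_mirror]; simp only [mirror_pos, flip_fst]; omega))
      rw [mirror_mirror] at this
      refine this.trans (linked_farLamp_of_width hl hn (n + 1) ?_ ?_ ?_)
      · simp [farLamp_pos]
      · rw [reach_mirror_farLamp]; push_cast; omega
      · rw [mirror_mirror, reach_farLamp hl]; push_cast; rfl

theorem connectionThickness_double [Finite L] [Nontrivial L] {n : ℕ} (hn : 2 ≤ n) :
    connectionThickness (doubleSwitchGenerators L) n = (n : ℕ∞) + 2 := by
  refine le_antisymm ?_ (le_sInf ?_)
  · exact_mod_cast connectionThickness_le (annulusInf_double_connected (L := L) hn)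
  · rintro _ ⟨r, hr, rfl⟩
    by_contra hlt
    have hlt' : r < n + 2 := by
      have : (r : ℕ∞) < ((n + 2 : ℕ) : ℕ∞) := by
        push_cast
        exact not_le.1 hlt
      exact_mod_cast this
    refine not_linked_walk (L := L) hn hlt' (linked_of_annulusInf_connected hr ⟨?_, ?_⟩ ⟨?_, ?_⟩)
    · rw [wordLength_double, tripLength_walk]; omega
    · exact walk_mem_infinitePart n
    · rw [wordLength_double, tripLength_walk]; omega
    · exact walk_neg_mem_infinitePart n

end Lamplighter

theorem theorem4 (L : Type*) [Group L] [Finite L] [Nontrivial L] :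
    ((Lamplighter.ladderGenerators L).Finite ∧
      Subgroup.closure (Lamplighter.ladderGenerators L) = ⊤ ∧
      (∀ n : ℕ, connectionThickness (Lamplighter.ladderGenerators L) n ≤ 24) ∧
      (∀ g : Lamplighter (ℤ × ZMod 2) L,
        retreatDepth (Lamplighter.ladderGenerators L) g ≤ 5)) ∧
    ((Lamplighter.doubleSwitchGenerators L).Finite ∧
      Subgroup.closure (Lamplighter.doubleSwitchGenerators L) = ⊤ ∧
      (∀ n : ℕ, 2 ≤ n →
        connectionThickness (Lamplighter.doubleSwitchGenerators L) n = (n : ℕ∞) + 2) ∧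
      (∀ d : ℕ, ∃ g : Lamplighter (ℤ × ZMod 2) L,
        IsDeadEnd (Lamplighter.doubleSwitchGenerators L) g ∧
          (d : ℕ∞) ≤ retreatDepth (Lamplighter.doubleSwitchGenerators L) g)) :=
  open Lamplighter in
  ⟨⟨finite_ladderGenerators, (ladder_metric L).2.1, connectionThickness_ladder_le,
    fun g => Cayley.retreatDepth_le (d := 5) (mem_infinitePart_ladder g)⟩,
   finite_doubleSwitchGenerators, (double_metric L).2.1, fun _ => connectionThickness_double,
   exists_deadEnd_double⟩
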